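/- **Setting.** Let $\mathcal M=(\mathcal S,\mathcal A,P,r,\gamma)$ be a discounted MDP with finite non-empty state and action spaces, $S=|\mathcal S|$, $A=|\mathcal A|$, $\gamma\in[0,1)$. When action $a$ is played in state $s$, the pair (next state, reward) is drawn from a law on $\mathcal S\times[0,R_{\max}]$, $R_{\max}>0$; $P(\cdot\mid s,a)$ is its first marginal and $r(s,a)$ the mean reward. For $\pi:\mathcal S\to\mathcal A$ let $V^\pi(s)$ be the expected discounted return of $\pi$ from $s$, let $V^\star(s)=\max_\pi V^\pi(s)$, and call $\pi^\star$ optimal if $V^{\pi^\star}=V^\star$. Put $V_\gamma=R_{\max}/(1-\gamma)$. Fix $\delta\in(0,1]$, $\mathcal E_{\max}\ge 1$ and a sequence $\lambda_t\in(0,1]$, $t=0,1,2,\dots$, and let $\Phi_t=R_{\max}\lambda_t$. Let $N^t(s,a)$ be the number of visits to $(s,a)$ before step $t$, and $\hat P^t,\hat r^t$ the empirical transition frequencies and mean rewards from these visits (both $0$ if $N^t(s,a)=0$). Let $\mathcal E^t(s,a)=1/\sqrt{N^t(s,a)}$, with $\mathcal E^t(s,a)=\mathcal E_{\max}$ if $N^t(s,a)=0$,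 and $P_U^t(s,a)=\mathcal E^t(s,a)/\mathcal E_{\max}$. Let the logarithmic factor $\ell_{1,t}$ be * (a) $\ell_{1,t}=\log\frac{24SA}{\delta}$, if $\lambda_t=\lambda$ does not depend on $t$; or * (b) $\ell_{1,t}=\log\frac{24SA(1+\log(t+1))}{\delta}$, for an arbitrary sequence $(\lambda_t)$, and let $\ell_{3,t}(s,a)=\log\frac{12SA(1+\log N^t(s,a))}{\delta}$. Put $$\Upsilon^t=\frac{7V_\gamma\ell_{1,t}}{\lambda_t},\qquad m_t=\frac{V_\gamma^2}{R_{\max}^2\lambda_t^2},\qquad \eta^t=\mathcal E_{\max}\Upsilon^t+R_{\max}\sqrt{m_t}.$$ **Algorithm (EUBRL).** At every step $t$ the agent forms the epistemically guided reward $$r^t_{\mathrm{EUBRL}}=(1-P_U^t)\,\hat r^t+P_U^t\,\eta^t\mathcal E^t,$$ computes the solution $V^t$ of the Bellman equation with values truncated at $V_\gamma$, $$V^t(s)=\max_a Q^t(s,a),\qquad Q^t(s,a)=\min\Big\{r^t_{\mathrm{EUBRL}}(s,a)+\gamma\sum_{s'}\hat P^t(s'\mid s,a)V^t(s'),\;V_\gamma\Big\},$$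 takes any policy $\pi_t$ with $\pi_t(s)\in\arg\max_a Q^t(s,a)$ for all $s$, and plays $a_t=\pi_t(s_t)$; given the past, $(s_{t+1},r_t)$ is drawn from the law attached to $(s_t,a_t)$. There is no reset. **Error terms.** For $N^t(s,a)\ge1$ let $$\beta^t(s,a)=P_U^t(s,a)\,\eta^t\mathcal E^t(s,a)+\frac1{N^t(s,a)}\Big(\frac{(4-P_U^t(s,a))V_\gamma\ell_{1,t}}{\lambda_t}+30\,V_\gamma S\,\ell_{3,t}(s,a)\Big),$$ and $\beta^t(s,a)=V_\gamma$ if $N^t(s,a)=0$. Let $J^t_\gamma$ be the unique solution of $$J^t_\gamma(s)=\min\Big\{\beta^t(s,\pi_t(s))+\gamma\sum_{s'}P(s'\mid s,\pi_t(s))J^t_\gamma(s'),\;V_\gamma\Big\},\qquad s\in\mathcal S.$$ **Theorem (bound of per-step regret).** There is a universal constant $C>0$ (independent of all the data above) such that, in both cases (a) and (b), with probability at least $1-\delta$, simultaneously for all $s\in\mathcal S$, all $t\ge0$ and all optimal policies $\pi^\star$, $$V^\star(s)-V^{\pi_t}(s)\le\Big(\frac92-\mathfrak R^t(s)\Big)\lambda_tV_\gamma+2J^t_\gamma(s)+C\,\Phi_t\Big(1+\frac{\Phi_t}{V_\gamma}\Big),$$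 where $\mathfrak R^t(s)=2P_U^t(s,\pi_t(s))+\frac97P_U^t(s,\pi^\star(s))$ is the epistemic resistance. -/

import Mathlib

open MeasureTheory Finset
open scoped NNReal ENNReal

universe u v w

/-- A discounted MDP with state space `S` and action space `A`.  `step s a` is the joint law of
(next state, reward) when action `a` is played in state `s`; rewards lie in `[0, Rmax]`. -/
structure DiscountedMDP (S A : Type*) [MeasurableSpace S] where
  step : S → A → Measure (S × ℝ)
  step_prob : ∀ s a, IsProbabilityMeasure (step s a)
  γ : ℝ
  γ_nonneg : 0 ≤ γ
  γ_lt_one : γ < 1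
  Rmax : ℝ
  Rmax_pos : 0 < Rmax
  reward_mem : ∀ s a, ∀ᵐ z ∂(step s a), z.2 ∈ Set.Icc 0 Rmax

section Operators

variable {S A : Type*} [Fintype S]

/-- One Bellman backup truncated at `cap`:
`min (rew(s,a) + γ ∑ s', ker(s' | s,a) V(s')) cap`. -/
noncomputable def clippedQ (γ cap : ℝ) (rew : S → A → ℝ) (ker : S → A → S → ℝ)
    (V : S → ℝ) (s : S) (a : A) : ℝ :=
  min (rew s a + γ * ∑ s', ker s a s' * V s') cap

theorem abs_clippedQ_sub_le {γ : ℝ} (hγ : 0 ≤ γ) (cap : ℝ) (rew : S → A → ℝ)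
    {ker : S → A → S → ℝ} (h0 : ∀ s a s', 0 ≤ ker s a s') (h1 : ∀ s a, ∑ s', ker s a s' ≤ 1)
    (V W : S → ℝ) (s : S) (a : A) :
    |clippedQ γ cap rew ker V s a - clippedQ γ cap rew ker W s a| ≤ γ * dist V W := by
  have key : |∑ s', ker s a s' * V s' - ∑ s', ker s a s' * W s'| ≤ dist V W := by
    rw [← Finset.sum_sub_distrib]
    calc |∑ s', (ker s a s' * V s' - ker s a s' * W s')|
        ≤ ∑ s', |ker s a s' * V s' - ker s a s' * W s'| := Finset.abs_sum_le_sum_abs _ _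
      _ ≤ ∑ s', ker s a s' * dist V W := by
          refine Finset.sum_le_sum fun s' _ => ?_
          rw [← mul_sub, abs_mul, abs_of_nonneg (h0 s a s')]
          have h := dist_le_pi_dist V W s'
          rw [Real.dist_eq] at h
          exact mul_le_mul_of_nonneg_left h (h0 s a s')
      _ = (∑ s', ker s a s') * dist V W := by rw [Finset.sum_mul]
      _ ≤ 1 * dist V W := mul_le_mul_of_nonneg_right (h1 s a) dist_nonneg
      _ = dist V W := one_mul _
  unfold clippedQ
  refine (abs_min_sub_min_le_max _ _ _ _).trans ?_
  rw [sub_self, abs_zero, max_eq_left (abs_nonneg _), add_sub_add_left_eq_sub, ← mul_sub,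
    abs_mul, abs_of_nonneg hγ]
  exact mul_le_mul_of_nonneg_left key hγ

/-- Truncated Bellman optimality operator. -/
noncomputable def clippedOpt [Fintype A] [Nonempty A] (γ cap : ℝ) (rew : S → A → ℝ)
    (ker : S → A → S → ℝ) (V : S → ℝ) : S → ℝ :=
  fun s => univ.sup' univ_nonempty fun a => clippedQ γ cap rew ker V s a

/-- Truncated Bellman evaluation operator of the policy `π`. -/
noncomputable def clippedEval (γ cap : ℝ) (rew : S → A → ℝ) (ker : S → A → S → ℝ) (π : S → A)
    (V : S → ℝ) : S → ℝ :=
  fun s => clippedQ γ cap rew ker V s (π s)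

theorem clippedOpt_contracting [Fintype A] [Nonempty A] {γ : ℝ} (hγ : 0 ≤ γ) (hγ1 : γ < 1)
    (cap : ℝ) (rew : S → A → ℝ) {ker : S → A → S → ℝ} (h0 : ∀ s a s', 0 ≤ ker s a s')
    (h1 : ∀ s a, ∑ s', ker s a s' ≤ 1) :
    ContractingWith (⟨γ, hγ⟩ : ℝ≥0) (clippedOpt γ cap rew ker) := by
  refine ⟨by exact_mod_cast hγ1, LipschitzWith.of_dist_le_mul fun V W => ?_⟩
  have aux : ∀ (V W : S → ℝ) (s : S),
      clippedOpt γ cap rew ker V s ≤ clippedOpt γ cap rew ker W s + γ * dist V W := by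
    intro V W s
    refine Finset.sup'_le _ _ fun a _ => ?_
    have h := (abs_le.1 (abs_clippedQ_sub_le hγ cap rew h0 h1 V W s a)).2
    have h' : clippedQ γ cap rew ker W s a ≤ clippedOpt γ cap rew ker W s :=
      Finset.le_sup' (fun a => clippedQ γ cap rew ker W s a) (mem_univ a)
    linarith
  refine (dist_pi_le_iff (by positivity)).2 fun s => ?_
  rw [Real.dist_eq]
  change _ ≤ γ * dist V W
  rw [abs_le]
  have e1 := aux V W s
  have e2 := aux W V s
  rw [dist_comm W V] at e2
  constructor <;> linarith

theorem clippedEval_contracting {γ : ℝ} (hγ : 0 ≤ γ) (hγ1 : γ < 1)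
    (cap : ℝ) (rew : S → A → ℝ) {ker : S → A → S → ℝ} (h0 : ∀ s a s', 0 ≤ ker s a s')
    (h1 : ∀ s a, ∑ s', ker s a s' ≤ 1) (π : S → A) :
    ContractingWith (⟨γ, hγ⟩ : ℝ≥0) (clippedEval γ cap rew ker π) := by
  refine ⟨by exact_mod_cast hγ1, LipschitzWith.of_dist_le_mul fun V W => ?_⟩
  refine (dist_pi_le_iff (by positivity)).2 fun s => ?_
  rw [Real.dist_eq]
  exact abs_clippedQ_sub_le hγ cap rew h0 h1 V W s (π s)

end Operators

namespace DiscountedMDP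

variable {S A : Type*} [MeasurableSpace S] (M : DiscountedMDP S A)

/-- Transition probability `P(s' | s, a)`. -/
noncomputable def P (s : S) (a : A) (s' : S) : ℝ := (M.step s a).real {z | z.1 = s'}

/-- Expected reward `r(s, a)`. -/
noncomputable def r (s : S) (a : A) : ℝ := ∫ z, z.2 ∂(M.step s a)

/-- Maximum value `V↑ = Rmax / (1 - γ)`. -/
noncomputable def Vmax : ℝ := M.Rmax / (1 - M.γ)

theorem P_nonneg (s : S) (a : A) (s' : S) : 0 ≤ M.P s a s' := measureReal_nonneg

theorem sum_P [Fintype S] [MeasurableSingletonClass S] (s : S) (a : A) :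
    ∑ s', M.P s a s' = 1 := by
  have := M.step_prob s a
  have h := measureReal_biUnion_finset (μ := M.step s a) (s := (univ : Finset S))
    (f := fun s' => {z : S × ℝ | z.1 = s'})
    (by
      intro x _ y _ hxy
      refine Set.disjoint_left.2 fun z hz hz' => hxy ?_
      simp only [Set.mem_ofPred_eq] at hz hz'
      exact hz.symm.trans hz')
    (fun x _ => measurable_fst (measurableSet_singleton x))
  have hU : (⋃ s' ∈ (univ : Finset S), {z : S × ℝ | z.1 = s'}) = Set.univ := by
    ext z; simp
  rw [hU, probReal_univ] at h
  exact h.symm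

variable [Fintype S] [DecidableEq S]

/-- Transition matrix of the policy `π`. -/
noncomputable def policyMatrix (π : S → A) : Matrix S S ℝ :=
  Matrix.of fun s s' => M.P s (π s) s'

/-- Expected return of `π` from `s`: the `l`-th term is `γ ^ l` times the expected reward at the
`l`-th step when starting in `s` and following `π`. -/
noncomputable def value (π : S → A) (s : S) : ℝ :=
  ∑' l : ℕ, M.γ ^ l * ((M.policyMatrix π ^ l).mulVec fun x => M.r x (π x)) s

/-- Optimal value. -/
noncomputable def optValue (s : S) : ℝ := ⨆ π : S → A, M.value π s

def IsOptimal (π : S → A) : Prop := ∀ s, M.value π s = M.optValue s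

end DiscountedMDP

/-- A realized trajectory: state and action at each step `t = 0, 1, 2, …`, and the reward received
for the action played at step `t`. -/
structure Trajectory (S A : Type*) where
  state : ℕ → S
  action : ℕ → A
  reward : ℕ → ℝ

namespace Trajectory

variable {S A : Type*} [DecidableEq S] [DecidableEq A] (h : Trajectory S A)

/-- Steps before `t` at which the pair `(s, a)` is visited. -/
def visitTimes (t : ℕ) (s : S) (a : A) : Finset ℕ :=
  (range t).filter fun τ => h.state τ = s ∧ h.action τ = a

/-- `N^t(s, a)`. -/
def N (t : ℕ) (s : S) (a : A) : ℕ := (h.visitTimes t s a).card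

/-- Empirical transition frequencies (identically `0` at unvisited pairs). -/
noncomputable def Phat (t : ℕ) (s : S) (a : A) (s' : S) : ℝ :=
  (((h.visitTimes t s a).filter fun τ => h.state (τ + 1) = s').card : ℝ) / h.N t s a

/-- Empirical mean reward (`0` at unvisited pairs). -/
noncomputable def rhat (t : ℕ) (s : S) (a : A) : ℝ :=
  (∑ τ ∈ h.visitTimes t s a, h.reward τ) / h.N t s a

theorem Phat_nonneg (t : ℕ) (s : S) (a : A) (s' : S) : 0 ≤ h.Phat t s a s' := by
  unfold Phat; positivity

theorem sum_Phat_le [Fintype S] (t : ℕ) (s : S) (a : A) : ∑ s', h.Phat t s a s' ≤ 1 := by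
  unfold Phat
  rw [← Finset.sum_div, ← Nat.cast_sum,
    ← Finset.card_eq_sum_card_fiberwise (f := fun τ => h.state (τ + 1)) (t := univ)
      (fun _ _ => by simp)]
  exact div_self_le_one _

/-- Epistemic uncertainty `1 / √N`; it takes its maximal value `Emax` at unvisited pairs. -/
noncomputable def epist (Emax : ℝ) (t : ℕ) (s : S) (a : A) : ℝ :=
  if h.N t s a = 0 then Emax else 1 / √(h.N t s a : ℝ)

/-- Probability of uncertainty `P_U = E / Emax`. -/
noncomputable def PU (Emax : ℝ) (t : ℕ) (s : S) (a : A) : ℝ := h.epist Emax t s a / Emax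

end Trajectory

namespace EUBRL

variable {S A : Type*} [MeasurableSpace S] [Fintype S] [Fintype A] [DecidableEq S] [DecidableEq A]
  (M : DiscountedMDP S A) (Emax : ℝ) (lam ell : ℕ → ℝ)

/-- `Υ^t = 7 V↑ ℓ_{1,t} / λ_t`. -/
noncomputable def Ups (t : ℕ) : ℝ := 7 * M.Vmax * ell t / lam t

/-- `m_t = V↑² / (Rmax² λ_t²)`. -/
noncomputable def m (t : ℕ) : ℝ := M.Vmax ^ 2 / (M.Rmax ^ 2 * lam t ^ 2)

/-- Scaling factor `η^t = Emax Υ^t + Rmax √m_t`. -/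
noncomputable def eta (t : ℕ) : ℝ := Emax * Ups M lam ell t + M.Rmax * √(m M lam t)

/-- Epistemically guided reward `(1 - P_U) r̂ + P_U η E`. -/
noncomputable def guidedReward (h : Trajectory S A) (t : ℕ) (s : S) (a : A) : ℝ :=
  (1 - h.PU Emax t s a) * h.rhat t s a
    + h.PU Emax t s a * (eta M Emax lam ell t * h.epist Emax t s a)

/-- Value function `V^t` of the agent: the solution of the empirical MDP with the epistemically
guided reward, with values truncated at `V↑`. -/
noncomputable def agentValue [Nonempty A] (h : Trajectory S A) (t : ℕ) : S → ℝ :=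
  ContractingWith.fixedPoint _
    (clippedOpt_contracting M.γ_nonneg M.γ_lt_one M.Vmax (guidedReward M Emax lam ell h t)
      (h.Phat_nonneg t) (h.sum_Phat_le t))

/-- `π` is greedy for the (truncated) action values of the agent at step `t`. -/
def IsGreedy [Nonempty A] (h : Trajectory S A) (t : ℕ) (π : S → A) : Prop :=
  ∀ s, clippedQ M.γ M.Vmax (guidedReward M Emax lam ell h t) (h.Phat t)
    (agentValue M Emax lam ell h t) s (π s) = agentValue M Emax lam ell h t s

/-- `ℓ_{3,t}(s, a) = log (12 S A (1 + log N^t(s, a)) / δ)`. -/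
noncomputable def ell3 (δ : ℝ) (h : Trajectory S A) (t : ℕ) (s : S) (a : A) : ℝ :=
  Real.log (12 * Fintype.card S * Fintype.card A * (1 + Real.log (h.N t s a)) / δ)

/-- Error term `β^t(s, a)`.  At an unvisited pair the formula reads `+∞`; as it is only used below
the truncation level `V↑`, it is replaced by `V↑` there. -/
noncomputable def beta (δ : ℝ) (h : Trajectory S A) (t : ℕ) (s : S) (a : A) : ℝ :=
  if h.N t s a = 0 then M.Vmax else
    h.PU Emax t s a * eta M Emax lam ell t * h.epist Emax t s a
      + 1 / (h.N t s a : ℝ) *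
        ((4 - h.PU Emax t s a) * M.Vmax * ell t / lam t
          + 30 * M.Vmax * Fintype.card S * ell3 δ h t s a)

/-- The function `J^t` of a policy `π`: the unique solution of
`J(s) = min (β(s, π s) + γ ∑ s', P(s' | s, π s) J(s')) V↑`. -/
noncomputable def J [MeasurableSingletonClass S] (δ : ℝ) (h : Trajectory S A) (t : ℕ)
    (π : S → A) : S → ℝ :=
  ContractingWith.fixedPoint _
    (clippedEval_contracting M.γ_nonneg M.γ_lt_one M.Vmax (beta M Emax lam ell δ h t)
      M.P_nonneg (fun s a => (M.sum_P s a).le) π)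

/-- Epistemic resistance. -/
noncomputable def resistance (h : Trajectory S A) (t : ℕ) (π πstar : S → A) (s : S) : ℝ :=
  2 * h.PU Emax t s (π s) + 9 / 7 * h.PU Emax t s (πstar s)

/-- The trajectory realized at the sample point `ω`, with actions `a_t = π_t(s_t)`. -/
def traj {Ω : Type*} (state : ℕ → Ω → S) (reward : ℕ → Ω → ℝ) (policy : ℕ → Ω → S → A)
    (ω : Ω) : Trajectory S A where
  state t := state t ω
  action t := policy t ω (state t ω)
  reward t := reward t ω

/-- The interaction of the agent with the MDP `M`: at each step `t` the agent follows a greedy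
policy computed from the data before step `t` (ties may be broken arbitrarily, also at random), and
given the past the pair (next state, reward) has law `M.step s_t a_t`. -/
structure IsRun [Nonempty A] [MeasurableSpace A] {Ω : Type*} [mΩ : MeasurableSpace Ω]
    (μ : Measure Ω) (ℱ : Filtration ℕ mΩ) (state : ℕ → Ω → S) (reward : ℕ → Ω → ℝ)
    (policy : ℕ → Ω → S → A) : Prop where
  state_meas : ∀ t, Measurable[ℱ t] (state t)
  policy_meas : ∀ t, Measurable[ℱ t] (policy t)
  reward_meas : ∀ t, Measurable[ℱ (t + 1)] (reward t)
  greedy : ∀ t ω, IsGreedy M Emax lam ell (traj state reward policy ω) t (policy t ω)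
  law : ∀ (t : ℕ) (B : Set (S × ℝ)), MeasurableSet B →
    μ[Set.indicator {ω | (state (t + 1) ω, reward t ω) ∈ B} (fun _ => (1 : ℝ)) | ℱ t]
      =ᵐ[μ] fun ω => (M.step (state t ω) (policy t ω (state t ω))).real B

end EUBRL

/-! The proof is a quasi-optimism argument in which exponential transforms replace variance
estimates. Write G for `M.Vmax`, Φ for `M.Rmax * lam t`, N for the number of visits to the pair at
hand, ℓ for `ell t`, and T for v ↦ log(1 + κv)/θ. Since exp(θT(v)) is affine in v, convexity of exp
bounds the exponential moment of θ(reward + γT(V*(s'))) by 1 + κQ*(s,a) = exp(θT(Q*(s,a))), where Q*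
is the one-step lookahead at V*. Multiplying the normalised exponentials over the visits to (s,a)
gives a nonnegative supermartingale, and Ville's inequality controls the empirical Bellman error of
T(V*) at all times at once, by log(1/ε)/(θN). No variance appears: its price is the distance between
T and the identity, at most θG²/2 for the lower transform T₋ (tilt -θ) and θG² for the upper
transform T₊ (tilt θ). With θG comparable to λ this price has order λG, and the error has order
Gℓ/(λN), which the bonus dominates.

The lower transform gives V^t ≥ T₋(V*) - Φ (`IsConcentrated.optimism`). For the other direction, d =
V^t - T₊(V*) satisfies d ≤ bonus + error - gap + γ P̂ d along the greedy policy, with gap = V* - Q*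
(`IsConcentrated.excess_le`); the gap survives because T₊ expands distances. As d depends on the
data, P̂ is replaced by P through deviation bounds for single transition entries, uniform in the
tilt: they yield P̂f ≤ log(P exp f) + error for every small f (`sum_mul_le_log_sum_mul_exp`). The
function z = 12G(exp(d/12G) - 1) then obeys a linear recursion under P (`exp_recursion_step`). The
regret D satisfies D = gap + γPD, so a maximum principle gives d + (21/25)D ≤ (42/25)J, and the
lower bound on d from quasi-optimism finishes (`IsConcentrated.regret_le`).

When λ depends on t, the tilts run over a geometric grid. Only about log(t+1) of them are needed,
because for λt < 1 every bonus exceeds G, J equals G, and the claim is trivial. -/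

/-- Maximum principle for a discounted substochastic kernel. -/
theorem nonpos_of_le_discounted_sum {S : Type*} [Fintype S] {γ : ℝ} (hγ : 0 ≤ γ) (hγ1 : γ < 1)
    {K : S → S → ℝ} (h0 : ∀ s s', 0 ≤ K s s') (h1 : ∀ s, ∑ s', K s s' ≤ 1) {f : S → ℝ}
    (hf : ∀ s, 0 < f s → f s ≤ γ * ∑ s', K s s' * f s') (s : S) : f s ≤ 0 := by
  by_contra! hs
  -- Only a maximiser with a positive value is examined, so the inequality for f is needed only
  -- where f > 0. This is what later handles truncation at `M.Vmax`.
  obtain ⟨m, -, hm⟩ := Finset.exists_max_image univ f ⟨s, mem_univ s⟩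
  have hpos : 0 < f m := hs.trans_le (hm s (mem_univ s))
  have hsum : ∑ s', K m s' * f s' ≤ 1 * f m :=
    calc ∑ s', K m s' * f s' ≤ ∑ s', K m s' * f m :=
          sum_le_sum fun x _ => mul_le_mul_of_nonneg_left (hm x (mem_univ x)) (h0 m x)
      _ = (∑ s', K m s') * f m := by rw [sum_mul]
      _ ≤ 1 * f m := mul_le_mul_of_nonneg_right (h1 m) hpos.le
  have := (hf m hpos).trans (mul_le_mul_of_nonneg_left hsum hγ)
  nlinarith

/-! ### Bellman equations and optimal policies. -/

namespace DiscountedMDP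

variable {S A : Type*} [MeasurableSpace S] (M : DiscountedMDP S A)

theorem r_nonneg (s : S) (a : A) : 0 ≤ M.r s a :=
  integral_nonneg_of_ae ((M.reward_mem s a).mono fun _ hz => hz.1)

theorem r_le (s : S) (a : A) : M.r s a ≤ M.Rmax := by
  have := M.step_prob s a
  have h := integral_mono_of_nonneg ((M.reward_mem s a).mono fun _ hz => hz.1)
    (integrable_const M.Rmax) ((M.reward_mem s a).mono fun _ hz => hz.2)
  simpa [r] using h

theorem one_sub_γ_pos : 0 < 1 - M.γ := sub_pos.2 M.γ_lt_one

theorem Vmax_pos : 0 < M.Vmax := div_pos M.Rmax_pos M.one_sub_γ_pos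

theorem Rmax_eq : M.Rmax = (1 - M.γ) * M.Vmax := by
  have := M.one_sub_γ_pos.ne'
  unfold Vmax
  field_simp

variable [Fintype S]

/-- Action value of a one-step lookahead with continuation `V`. -/
noncomputable def lookahead (V : S → ℝ) (s : S) (a : A) : ℝ :=
  M.r s a + M.γ * ∑ s', M.P s a s' * V s'

theorem lookahead_nonneg {V : S → ℝ} (hV : ∀ s, 0 ≤ V s) (s : S) (a : A) :
    0 ≤ M.lookahead V s a :=
  add_nonneg (M.r_nonneg s a)
    (mul_nonneg M.γ_nonneg (sum_nonneg fun x _ => mul_nonneg (M.P_nonneg s a x) (hV x)))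

variable [DecidableEq S]

theorem value_le_optValue [Finite A] (π : S → A) (s : S) : M.value π s ≤ M.optValue s :=
  le_ciSup (f := fun π : S → A => M.value π s) (Set.finite_range _).bddAbove π

variable [MeasurableSingletonClass S]

theorem pow_mulVec_mem (π : S → A) (l : ℕ) :
    ∀ s, ((M.policyMatrix π ^ l).mulVec fun x => M.r x (π x)) s ∈ Set.Icc 0 M.Rmax := by
  induction l with
  | zero => intro s; simpa using ⟨M.r_nonneg s (π s), M.r_le s (π s)⟩
  | succ l ih =>
    intro s
    rw [pow_succ', ← Matrix.mulVec_mulVec]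
    simp only [Matrix.mulVec, dotProduct, policyMatrix, Matrix.of_apply] at ih ⊢
    refine ⟨sum_nonneg fun x _ => mul_nonneg (M.P_nonneg _ _ _) (ih x).1, ?_⟩
    refine (sum_le_sum fun x _ => mul_le_mul_of_nonneg_left (ih x).2 (M.P_nonneg _ _ _)).trans ?_
    rw [← sum_mul, M.sum_P, one_mul]

theorem summable_value (π : S → A) (s : S) :
    Summable fun l : ℕ => M.γ ^ l * ((M.policyMatrix π ^ l).mulVec fun x => M.r x (π x)) s :=
  Summable.of_nonneg_of_le
    (fun l => mul_nonneg (pow_nonneg M.γ_nonneg l) (M.pow_mulVec_mem π l s).1)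
    (fun l => mul_le_mul_of_nonneg_left (M.pow_mulVec_mem π l s).2 (pow_nonneg M.γ_nonneg l))
    ((summable_geometric_of_lt_one M.γ_nonneg M.γ_lt_one).mul_right M.Rmax)

theorem value_eq (π : S → A) (s : S) : M.value π s = M.lookahead (M.value π) s (π s) := by
  unfold value lookahead
  rw [(M.summable_value π s).tsum_eq_zero_add]
  congr 1
  · simp
  · have h : ∀ l : ℕ, M.γ ^ (l + 1) *
          ((M.policyMatrix π ^ (l + 1)).mulVec fun x => M.r x (π x)) s
        = ∑ s', M.γ * (M.P s (π s) s' *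
          (M.γ ^ l * ((M.policyMatrix π ^ l).mulVec fun x => M.r x (π x)) s')) := by
      intro l
      rw [pow_succ' (M.policyMatrix π), ← Matrix.mulVec_mulVec, Matrix.mulVec, dotProduct, mul_sum]
      refine sum_congr rfl fun x _ => ?_
      simp only [policyMatrix, Matrix.of_apply]
      ring
    simp_rw [h]
    rw [Summable.tsum_finsetSum fun x _ => ((M.summable_value π x).mul_left _).mul_left _, mul_sum]
    simp_rw [tsum_mul_left]

theorem value_nonneg (π : S → A) (s : S) : 0 ≤ M.value π s :=
  tsum_nonneg fun l => mul_nonneg (pow_nonneg M.γ_nonneg l) (M.pow_mulVec_mem π l s).1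

theorem le_value_of_le_lookahead {π : S → A} {V : S → ℝ}
    (h : ∀ s, V s ≤ M.lookahead V s (π s)) (s : S) : V s ≤ M.value π s := by
  have := nonpos_of_le_discounted_sum M.γ_nonneg M.γ_lt_one (K := fun s s' => M.P s (π s) s')
    (fun s s' => M.P_nonneg _ _ _) (fun s => (M.sum_P s (π s)).le)
    (f := fun s => V s - M.value π s) (fun x _ => by
      have h1 := h x
      rw [M.value_eq π x]
      simp only [lookahead, mul_sub, sum_sub_distrib] at h1 ⊢
      linarith) s
  linarith

theorem value_le_Vmax (π : S → A) (s : S) : M.value π s ≤ M.Vmax := by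
  have := nonpos_of_le_discounted_sum M.γ_nonneg M.γ_lt_one (K := fun s s' => M.P s (π s) s')
    (fun s s' => M.P_nonneg _ _ _) (fun s => (M.sum_P s (π s)).le)
    (f := fun s => M.value π s - M.Vmax) (fun x _ => by
      have h1 := M.r_le x (π x)
      rw [M.value_eq π x]
      simp only [lookahead, mul_sub, sum_sub_distrib, ← sum_mul, M.sum_P]
      rw [M.Rmax_eq] at h1
      linarith) s
  linarith

theorem optValue_nonneg [Finite A] [Nonempty A] (s : S) : 0 ≤ M.optValue s :=
  (M.value_nonneg (fun _ => Classical.arbitrary A) s).trans (M.value_le_optValue _ s)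

theorem optValue_le_Vmax [Nonempty A] (s : S) : M.optValue s ≤ M.Vmax :=
  ciSup_le fun π => M.value_le_Vmax π s

variable {M}

theorem IsOptimal.lookahead_eq {π : S → A} (h : M.IsOptimal π) (s : S) :
    M.lookahead M.optValue s (π s) = M.optValue s := by
  have : M.value π = M.optValue := funext h
  rw [← this]
  exact (M.value_eq π s).symm

/-- Policy improvement: if switching to a at the single state s gave a strictly larger lookahead,
the modified policy would have value at least V*, hence equal to V*, and its Bellman equation at s
would contradict the strict gain. -/
theorem IsOptimal.lookahead_le [Finite A] {π : S → A} (h : M.IsOptimal π) (s : S) (a : A) :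
    M.lookahead M.optValue s a ≤ M.optValue s := by
  by_contra! hlt
  have hle : ∀ x, M.optValue x ≤ M.lookahead M.optValue x (Function.update π s a x) := by
    intro x
    by_cases hx : x = s
    · subst hx; simpa using hlt.le
    · rw [Function.update_of_ne hx]; exact (h.lookahead_eq x).ge
  have heq : M.value (Function.update π s a) = M.optValue := funext fun x =>
    le_antisymm (M.value_le_optValue _ x) (M.le_value_of_le_lookahead hle x)
  have := M.value_eq (Function.update π s a) s
  rw [heq, Function.update_self] at this
  linarith

end DiscountedMDP

/-! ### Time-uniform exponential inequalities along a run. -/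

/-- **Ville's inequality** for nonnegative processes whose integral over past events decreases. -/
theorem mul_measure_exists_le_le_one {Ω : Type*} [mΩ : MeasurableSpace Ω] {μ : Measure Ω}
    {ℱ : Filtration ℕ mΩ} {X : ℕ → Ω → ℝ≥0∞} (hX : ∀ t, Measurable[ℱ t] (X t))
    (h0 : ∫⁻ ω, X 0 ω ∂μ ≤ 1)
    (hstep : ∀ t F, MeasurableSet[ℱ t] F → ∫⁻ ω in F, X (t + 1) ω ∂μ ≤ ∫⁻ ω in F, X t ω ∂μ)
    (K : ℝ≥0∞) : K * μ {ω | ∃ t, K ≤ X t ω} ≤ 1 := by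
  set B : ℕ → Set Ω := fun T => {ω | ∃ t ≤ T, K ≤ X t ω} with hB
  have hBm : ∀ T, MeasurableSet[ℱ T] (B T) := by
    intro T
    have : B T = ⋃ t ∈ Set.Iic T, {ω | K ≤ X t ω} := by ext ω; simp [hB]
    rw [this]
    exact MeasurableSet.biUnion (Set.to_countable _) fun t ht =>
      ℱ.mono ht _ (measurableSet_le measurable_const (hX t))
  have hsucc : ∀ T, B (T + 1) = B T ∪ {ω | K ≤ X (T + 1) ω} := by
    intro T
    ext ω
    simp only [hB, Set.mem_union, Set.mem_ofPred_eq]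
    constructor
    · rintro ⟨t, ht, h⟩
      rcases Nat.le_succ_iff.1 ht with h' | h'
      · exact Or.inl ⟨t, h', h⟩
      · subst h'; exact Or.inr h
    · rintro (⟨t, ht, h⟩ | h)
      · exact ⟨t, ht.trans (Nat.le_succ T), h⟩
      · exact ⟨T + 1, le_rfl, h⟩
  -- Markov's inequality on the part of F where the level K is reached, keeping the integral over
  -- the rest of F.
  have hmark : ∀ t (F : Set Ω), MeasurableSet F →
      K * μ (F ∩ {ω | K ≤ X t ω}) + ∫⁻ ω in F ∩ {ω | K ≤ X t ω}ᶜ, X t ω ∂μ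
        ≤ ∫⁻ ω in F, X t ω ∂μ := by
    intro t F hF
    have hm : MeasurableSet {ω | K ≤ X t ω} :=
      ℱ.le t _ (measurableSet_le measurable_const (hX t))
    rw [← lintegral_inter_add_sdiff (X t) F hm, Set.sdiff_eq]
    gcongr
    rw [← setLIntegral_const]
    exact setLIntegral_mono' (hF.inter hm) fun ω hω => hω.2
  -- The process stopped on reaching K: mass K is booked on paths that have crossed, and the
  -- integral is continued only on the others.
  have main : ∀ T, K * μ (B T) + ∫⁻ ω in (B T)ᶜ, X T ω ∂μ ≤ 1 := by
    intro T
    induction T with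
    | zero =>
      have h := hmark 0 Set.univ MeasurableSet.univ
      have hB0 : B 0 = {ω | K ≤ X 0 ω} := by ext ω; simp [hB]
      simp only [Set.univ_inter, Measure.restrict_univ] at h
      rw [hB0]
      exact h.trans h0
    | succ T ih =>
      have hF : MeasurableSet[ℱ T] (B T)ᶜ := (hBm T).compl
      have h := hmark (T + 1) (B T)ᶜ (ℱ.le T _ hF)
      have hc : (B (T + 1))ᶜ = (B T)ᶜ ∩ {ω | K ≤ X (T + 1) ω}ᶜ := by
        rw [hsucc, Set.compl_union]
      have hu : B (T + 1) = B T ∪ ((B T)ᶜ ∩ {ω | K ≤ X (T + 1) ω}) := by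
        rw [hsucc]; ext ω; simp only [Set.mem_union, Set.mem_inter_iff, Set.mem_compl_iff]; tauto
      calc K * μ (B (T + 1)) + ∫⁻ ω in (B (T + 1))ᶜ, X (T + 1) ω ∂μ
          ≤ K * (μ (B T) + μ ((B T)ᶜ ∩ {ω | K ≤ X (T + 1) ω}))
            + ∫⁻ ω in (B (T + 1))ᶜ, X (T + 1) ω ∂μ := by
            gcongr
            rw [hu]
            exact measure_union_le _ _
        _ = K * μ (B T) + (K * μ ((B T)ᶜ ∩ {ω | K ≤ X (T + 1) ω})
            + ∫⁻ ω in (B T)ᶜ ∩ {ω | K ≤ X (T + 1) ω}ᶜ, X (T + 1) ω ∂μ) := by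
            rw [mul_add, add_assoc, hc]
        _ ≤ K * μ (B T) + ∫⁻ ω in (B T)ᶜ, X T ω ∂μ := by
            gcongr
            exact h.trans (hstep T _ hF)
        _ ≤ 1 := ih
  have hU : {ω | ∃ t, K ≤ X t ω} = ⋃ T, B T := by
    ext ω
    simp only [hB, Set.mem_ofPred_eq, Set.mem_iUnion]
    exact ⟨fun ⟨t, h⟩ => ⟨t, t, le_rfl, h⟩, fun ⟨_, t, _, h⟩ => ⟨t, h⟩⟩
  have hmono : Monotone B := fun T T' h ω ⟨t, ht, h'⟩ => ⟨t, ht.trans h, h'⟩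
  rw [hU, hmono.measure_iUnion, ENNReal.mul_iSup]
  exact iSup_le fun T => le_self_add.trans (main T)

/-- The weights 1/((j+1)(j+2)) telescope, so the j-th tilt can receive failure probability
ε/((j+1)(j+2)). -/
theorem tsum_ofReal_div_mul_succ_le {ε : ℝ} (hε : 0 ≤ ε) :
    ∑' j : ℕ, ENNReal.ofReal (ε / ((j + 1) * (j + 2))) ≤ ENNReal.ofReal ε := by
  refine ENNReal.tsum_le_of_sum_range_le fun n => ?_
  have h : ∀ n : ℕ, ∑ j ∈ range n, ε / (((j : ℝ) + 1) * (j + 2)) = ε - ε / (n + 1) := by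
    intro n
    induction n with
    | zero => simp
    | succ n ih =>
      rw [sum_range_succ, ih]
      push_cast
      field_simp
      ring
  rw [← ENNReal.ofReal_sum_of_nonneg fun j _ => by positivity, h]
  exact ENNReal.ofReal_le_ofReal (sub_le_self _ (by positivity))

namespace EUBRL

variable {S A Ω : Type*} [MeasurableSpace S] [Fintype S] [Fintype A] [DecidableEq S]
  [DecidableEq A] [Nonempty A] [MeasurableSpace A] {mΩ : MeasurableSpace Ω}
  {M : DiscountedMDP S A} {Emax : ℝ} {lam ell : ℕ → ℝ}
  {μ : Measure Ω} {ℱ : Filtration ℕ mΩ} {state : ℕ → Ω → S} {reward : ℕ → Ω → ℝ}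
  {policy : ℕ → Ω → S → A}

namespace IsRun

variable (hrun : IsRun M Emax lam ell μ ℱ state reward policy)
include hrun

theorem outcome_meas (t : ℕ) : Measurable[ℱ (t + 1)] fun ω => (state (t + 1) ω, reward t ω) :=
  (hrun.state_meas (t + 1)).prodMk (hrun.reward_meas t)

/-- On a past event that fixes the current pair the conditional law of the outcome is constant; the
defining integral identity of conditional expectation makes this an identity of measures. -/
theorem map_restrict_outcome [IsProbabilityMeasure μ] (t : ℕ) (s : S) (a : A)
    {F : Set Ω} (hF : MeasurableSet[ℱ t] F)
    (hFs : F ⊆ {ω | state t ω = s ∧ policy t ω (state t ω) = a}) :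
    (μ.restrict F).map (fun ω => (state (t + 1) ω, reward t ω)) = μ F • M.step s a := by
  have := M.step_prob s a
  have hY : Measurable fun ω => (state (t + 1) ω, reward t ω) :=
    (hrun.outcome_meas t).mono (ℱ.le _) le_rfl
  ext B hB
  have hYB := hY hB
  have h := setIntegral_condExp (ℱ.le t)
    ((integrable_const (1 : ℝ)).indicator hYB : Integrable _ μ) hF
  rw [setIntegral_congr_ae (g := fun _ => (M.step s a).real B) (ℱ.le t _ hF)
    ((hrun.law t B hB).mono fun ω hω hωF => by
      obtain ⟨h1, h2⟩ := hFs hωF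
      refine hω.trans ?_
      simp only [h1] at h2 ⊢
      rw [h2])] at h
  rw [Measure.map_apply hY hB, Measure.restrict_apply hYB, Measure.smul_apply, smul_eq_mul]
  rw [integral_indicator hYB, Measure.restrict_restrict hYB] at h
  simp only [integral_const, measureReal_restrict_apply_univ, smul_eq_mul, mul_one] at h
  rw [← ENNReal.toReal_eq_toReal_iff' (measure_ne_top _ _)
    (ENNReal.mul_ne_top (measure_ne_top _ _) (measure_ne_top _ _)), ENNReal.toReal_mul]
  exact h.symm

/-- Once the current pair is fixed, the outcome is independent of the past; the identity passes from
indicators to all nonnegative past-measurable G by monotone classes. -/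
theorem lintegral_mul_outcome [IsProbabilityMeasure μ] (t : ℕ) (s : S) (a : A)
    {f : S × ℝ → ℝ≥0∞} (hf : Measurable f)
    {F : Set Ω} (hF : MeasurableSet[ℱ t] F)
    (hFs : F ⊆ {ω | state t ω = s ∧ policy t ω (state t ω) = a}) {G : Ω → ℝ≥0∞}
    (hG : Measurable[ℱ t] G) :
    ∫⁻ ω in F, G ω * f (state (t + 1) ω, reward t ω) ∂μ
      = (∫⁻ ω in F, G ω ∂μ) * ∫⁻ z, f z ∂(M.step s a) := by
  have hY : Measurable fun ω => (state (t + 1) ω, reward t ω) :=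
    (hrun.outcome_meas t).mono (ℱ.le _) le_rfl
  have hfY : Measurable fun ω => f (state (t + 1) ω, reward t ω) := hf.comp hY
  refine Measurable.ennreal_induction (mα := ℱ t)
    (motive := fun G => ∫⁻ ω in F, G ω * f (state (t + 1) ω, reward t ω) ∂μ
      = (∫⁻ ω in F, G ω ∂μ) * ∫⁻ z, f z ∂(M.step s a)) ?_ ?_ ?_ hG
  · intro c E hE
    have hE' := ℱ.le t _ hE
    have e1 : (fun ω => E.indicator (fun _ => c) ω * f (state (t + 1) ω, reward t ω))
        = E.indicator fun ω => c * f (state (t + 1) ω, reward t ω) := by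
      ext ω; by_cases h : ω ∈ E <;> simp [h]
    rw [e1, lintegral_indicator hE', lintegral_indicator hE', Measure.restrict_restrict hE',
      lintegral_const_mul c hfY, ← lintegral_map (μ := μ.restrict (E ∩ F)) hf hY,
      hrun.map_restrict_outcome t s a (hE.inter hF) (Set.inter_subset_right.trans hFs),
      lintegral_smul_measure, setLIntegral_const, smul_eq_mul, mul_assoc]
  · intro g₁ g₂ _ h₁ h₂ i₁ i₂
    simp only [Pi.add_apply, add_mul]
    have hm : Measurable fun ω => g₁ ω * f (state (t + 1) ω, reward t ω) :=
      (h₁.mono (ℱ.le t) le_rfl).mul hfY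
    rw [lintegral_add_left hm,
      lintegral_add_left (h₁.mono (ℱ.le t) le_rfl), i₁, i₂, add_mul]
  · intro g hg hmono ih
    simp only [ENNReal.iSup_mul]
    have hm : ∀ n, Measurable fun ω => g n ω * f (state (t + 1) ω, reward t ω) :=
      fun n => ((hg n).mono (ℱ.le t) le_rfl).mul hfY
    rw [lintegral_iSup hm (fun i j hij ω => mul_le_mul_left (hmono hij ω) _),
      lintegral_iSup (fun n => (hg n).mono (ℱ.le t) le_rfl) hmono, ENNReal.iSup_mul]
    simp only [ih]

theorem action_meas [MeasurableSingletonClass S] (t : ℕ) :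
    Measurable[ℱ t] fun ω => policy t ω (state t ω) := by
  have h1 : Measurable[ℱ t] fun ω => (policy t ω, state t ω) :=
    (hrun.policy_meas t).prodMk (hrun.state_meas t)
  have h2 : Measurable fun p : (S → A) × S => p.1 p.2 := measurable_from_prod_countable_left
    fun s => measurable_pi_apply s
  exact h2.comp h1

variable [MeasurableSingletonClass S] [MeasurableSingletonClass A]

theorem visit_measurableSet (t : ℕ) (s : S) (a : A) :
    MeasurableSet[ℱ t] {ω | state t ω = s ∧ policy t ω (state t ω) = a} :=
  MeasurableSet.inter (hrun.state_meas t (measurableSet_singleton s))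
    (hrun.action_meas t (measurableSet_singleton a))

variable [IsProbabilityMeasure μ]

/-- Time-uniform exponential tail bound for sums over the visits to one state-action pair. -/
theorem measure_exists_visit_sum_le (s : S) (a : A) {W : S × ℝ → ℝ} (hW : Measurable W) {c : ℝ}
    (hc : ∫⁻ z, ENNReal.ofReal (Real.exp (W z)) ∂(M.step s a) ≤ ENNReal.ofReal (Real.exp c))
    {ε : ℝ} (hε : 0 < ε) :
    μ {ω | ∃ t, Real.log (1 / ε) ≤
      ∑ τ ∈ (traj state reward policy ω).visitTimes t s a,
        (W (state (τ + 1) ω, reward τ ω) - c)} ≤ ENNReal.ofReal ε := by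
  set E : ℕ → Set Ω := fun t => {ω | state t ω = s ∧ policy t ω (state t ω) = a} with hE
  set f : S × ℝ → ℝ≥0∞ := fun z => ENNReal.ofReal (Real.exp (W z - c)) with hf
  have hfm : Measurable f := by fun_prop
  have hf1 : ∫⁻ z, f z ∂(M.step s a) ≤ 1 := by
    have : f = fun z => ENNReal.ofReal (Real.exp (-c)) * ENNReal.ofReal (Real.exp (W z)) := by
      ext z
      rw [← ENNReal.ofReal_mul (Real.exp_nonneg _), ← Real.exp_add, hf]
      ring_nf
    rw [this, lintegral_const_mul _ (by fun_prop)]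
    refine (mul_le_mul_right hc _).trans ?_
    rw [← ENNReal.ofReal_mul (Real.exp_nonneg _), ← Real.exp_add]
    simp
  classical
  -- A factor of mean at most 1 at each visit and the factor 1 at all other steps. Ville's
  -- inequality for this product is uniform in t, so the random visit count costs no union bound.
  set X : ℕ → Ω → ℝ≥0∞ := fun t ω =>
    ∏ τ ∈ range t, if ω ∈ E τ then f (state (τ + 1) ω, reward τ ω) else 1 with hX
  have hXm : ∀ t, Measurable[ℱ t] (X t) := by
    intro t
    refine Finset.measurable_prod _ fun τ hτ => ?_
    have hτ' := mem_range.1 hτ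
    exact Measurable.ite (ℱ.mono hτ'.le _ (hrun.visit_measurableSet τ s a))
      (hfm.comp ((hrun.outcome_meas τ).mono (ℱ.mono hτ') le_rfl)) measurable_const
  have hville := mul_measure_exists_le_le_one (μ := μ) hXm (by simp [hX]) (by
    intro t F hF
    have hEm := hrun.visit_measurableSet t s a
    rw [← lintegral_inter_add_sdiff _ F (ℱ.le t _ hEm),
      ← lintegral_inter_add_sdiff (X t) F (ℱ.le t _ hEm)]
    have hsucc : ∀ ω, X (t + 1) ω
        = X t ω * if ω ∈ E t then f (state (t + 1) ω, reward t ω) else 1 :=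
      fun ω => prod_range_succ _ _
    refine add_le_add ?_ ?_
    · rw [setLIntegral_congr_fun (g := fun ω => X t ω * f (state (t + 1) ω, reward t ω))
        (ℱ.le t _ (hF.inter hEm)) (fun ω hω => by
          dsimp only
          rw [hsucc, if_pos (show ω ∈ E t from hω.2)]),
        hrun.lintegral_mul_outcome t s a hfm (hF.inter hEm) Set.inter_subset_right (hXm t)]
      exact mul_le_of_le_one_right' hf1
    · refine (setLIntegral_congr_fun (ℱ.le t _ (hF.diff hEm)) (fun ω hω => ?_)).le
      rw [hsucc, if_neg (show ω ∉ E t from hω.2), mul_one]) (ENNReal.ofReal (1 / ε))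
  have hXe : ∀ t ω, X t ω = ENNReal.ofReal (Real.exp
      (∑ τ ∈ (traj state reward policy ω).visitTimes t s a,
        (W (state (τ + 1) ω, reward τ ω) - c))) := by
    intro t ω
    rw [Real.exp_sum, ENNReal.ofReal_prod_of_nonneg fun _ _ => Real.exp_nonneg _,
      Trajectory.visitTimes, prod_filter]
    rfl
  have hset : {ω | ∃ t, Real.log (1 / ε) ≤
      ∑ τ ∈ (traj state reward policy ω).visitTimes t s a,
        (W (state (τ + 1) ω, reward τ ω) - c)} = {ω | ∃ t, ENNReal.ofReal (1 / ε) ≤ X t ω} := by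
    ext ω
    simp only [Set.mem_ofPred_eq, hXe]
    refine exists_congr fun t => ?_
    rw [ENNReal.ofReal_le_ofReal_iff (Real.exp_nonneg _), Real.log_le_iff_le_exp (by positivity)]
  rw [hset]
  have hK : ENNReal.ofReal ε * ENNReal.ofReal (1 / ε) = 1 := by
    rw [← ENNReal.ofReal_mul hε.le, mul_one_div_cancel hε.ne', ENNReal.ofReal_one]
  calc μ {ω | ∃ t, ENNReal.ofReal (1 / ε) ≤ X t ω}
      = ENNReal.ofReal ε *
          (ENNReal.ofReal (1 / ε) * μ {ω | ∃ t, ENNReal.ofReal (1 / ε) ≤ X t ω}) := by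
        rw [← mul_assoc, hK, one_mul]
    _ ≤ ENNReal.ofReal ε * 1 := by gcongr
    _ = ENNReal.ofReal ε := mul_one _

/-- Union of `measure_exists_visit_sum_le` over a sequence of functions. -/
theorem measure_exists_seq_visit_sum_le (s : S) (a : A) {W : ℕ → S × ℝ → ℝ}
    (hW : ∀ j, Measurable (W j)) {c : ℕ → ℝ}
    (hc : ∀ j, ∫⁻ z, ENNReal.ofReal (Real.exp (W j z)) ∂(M.step s a)
      ≤ ENNReal.ofReal (Real.exp (c j))) {ε : ℝ} (hε : 0 < ε) :
    μ {ω | ∃ (j : ℕ) (t : ℕ), Real.log ((j + 1) * (j + 2) / ε) ≤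
      ∑ τ ∈ (traj state reward policy ω).visitTimes t s a,
        (W j (state (τ + 1) ω, reward τ ω) - c j)} ≤ ENNReal.ofReal ε := by
  rw [show {ω | ∃ (j : ℕ) (t : ℕ), Real.log ((j + 1) * (j + 2) / ε) ≤
      ∑ τ ∈ (traj state reward policy ω).visitTimes t s a,
        (W j (state (τ + 1) ω, reward τ ω) - c j)} =
      ⋃ j : ℕ, {ω | ∃ t : ℕ, Real.log ((j + 1) * (j + 2) / ε) ≤
      ∑ τ ∈ (traj state reward policy ω).visitTimes t s a,
        (W j (state (τ + 1) ω, reward τ ω) - c j)} from by ext ω; simp]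
  refine (measure_iUnion_le _).trans (le_trans ?_ (tsum_ofReal_div_mul_succ_le hε.le))
  refine ENNReal.tsum_le_tsum fun j => ?_
  have h := hrun.measure_exists_visit_sum_le s a (hW j) (hc j)
    (ε := ε / (((j : ℝ) + 1) * (j + 2))) (by positivity)
  rwa [one_div_div] at h

theorem ae_reward_mem : ∀ᵐ ω ∂μ, ∀ t, reward t ω ∈ Set.Icc 0 M.Rmax := by
  refine ae_all_iff.2 fun t => ?_
  have hB : MeasurableSet {z : S × ℝ | z.2 ∉ Set.Icc 0 M.Rmax} :=
    (measurable_snd measurableSet_Icc).compl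
  have hY : Measurable fun ω => (state (t + 1) ω, reward t ω) :=
    (hrun.outcome_meas t).mono (ℱ.le _) le_rfl
  rw [ae_iff]
  have hsub : {ω | reward t ω ∉ Set.Icc 0 M.Rmax} ⊆ ⋃ p : S × A,
      {ω | state t ω = p.1 ∧ policy t ω (state t ω) = p.2} ∩
        (fun ω => (state (t + 1) ω, reward t ω)) ⁻¹' {z : S × ℝ | z.2 ∉ Set.Icc 0 M.Rmax} :=
    fun ω hω => Set.mem_iUnion.2 ⟨(state t ω, policy t ω (state t ω)), ⟨rfl, rfl⟩, hω⟩
  refine measure_mono_null hsub (measure_iUnion_null fun p => ?_)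
  have h := congrArg (fun ν => ν {z : S × ℝ | z.2 ∉ Set.Icc 0 M.Rmax})
    (hrun.map_restrict_outcome t p.1 p.2 (hrun.visit_measurableSet t p.1 p.2) subset_rfl)
  simp only [Measure.smul_apply, smul_eq_mul] at h
  rw [Measure.map_apply hY hB, Measure.restrict_apply (hY hB),
    show M.step p.1 p.2 {z : S × ℝ | z.2 ∉ Set.Icc 0 M.Rmax} = 0 from
      ae_iff.1 (M.reward_mem p.1 p.2), mul_zero, Set.inter_comm] at h
  exact h

end IsRun

end EUBRL

/-! ### Empirical averages as sums over visits. -/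

namespace Trajectory

variable {S A : Type*} [DecidableEq S] [DecidableEq A] (h : Trajectory S A)

theorem N_le (t : ℕ) (s : S) (a : A) : h.N t s a ≤ t :=
  (card_filter_le _ _).trans (card_range t).le

theorem N_mul_rhat (t : ℕ) (s : S) (a : A) :
    h.N t s a * h.rhat t s a = ∑ τ ∈ h.visitTimes t s a, h.reward τ := by
  unfold rhat
  refine mul_div_cancel_of_imp' fun h0 => ?_
  rw [Nat.cast_eq_zero, N, card_eq_zero] at h0
  rw [h0, sum_empty]

theorem N_mul_Phat (t : ℕ) (s : S) (a : A) (s' : S) :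
    h.N t s a * h.Phat t s a s'
      = ∑ τ ∈ h.visitTimes t s a, if h.state (τ + 1) = s' then (1 : ℝ) else 0 := by
  unfold Phat
  rw [sum_boole]
  refine mul_div_cancel_of_imp' fun h0 => ?_
  rw [Nat.cast_eq_zero, N, card_eq_zero] at h0
  rw [h0, filter_empty, card_empty, Nat.cast_zero]

theorem N_mul_sum_Phat [Fintype S] (t : ℕ) (s : S) (a : A) (f : S → ℝ) :
    h.N t s a * ∑ s', h.Phat t s a s' * f s'
      = ∑ τ ∈ h.visitTimes t s a, f (h.state (τ + 1)) := by
  simp_rw [mul_sum, ← mul_assoc, N_mul_Phat, sum_mul]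
  rw [sum_comm]
  simp

theorem sum_Phat [Fintype S] {t : ℕ} {s : S} {a : A} (hN : h.N t s a ≠ 0) :
    ∑ s', h.Phat t s a s' = 1 := by
  have h1 := h.N_mul_sum_Phat t s a fun _ => 1
  simp only [mul_one, sum_const, nsmul_eq_mul] at h1
  change _ = (h.N t s a : ℝ) at h1
  exact (mul_eq_left₀ (Nat.cast_ne_zero.2 hN)).1 h1

theorem rhat_mem {R : ℝ} (hR : 0 ≤ R) (hr : ∀ t, h.reward t ∈ Set.Icc 0 R) (t : ℕ) (s : S)
    (a : A) :
    h.rhat t s a ∈ Set.Icc 0 R := by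
  refine ⟨div_nonneg (sum_nonneg fun τ _ => (hr τ).1) (Nat.cast_nonneg _),
    div_le_of_le_mul₀ (Nat.cast_nonneg _) hR ?_⟩
  refine (sum_le_sum fun τ _ => (hr τ).2).trans ?_
  rw [sum_const, nsmul_eq_mul, mul_comm]
  rfl

end Trajectory

/-! ### Exponential transforms and their deviation bounds. -/

/-- The function `v ↦ log (1 + κ v) / θ`, for which `exp (θ · expTransform θ κ v)` is affine. -/
noncomputable def expTransform (θ κ v : ℝ) : ℝ := Real.log (1 + κ * v) / θ

/-- An affine function equal to 1 at 0 and positive at G is positive in between. -/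
theorem one_add_mul_pos {κ G v : ℝ} (hG : 0 < 1 + κ * G) (hv : v ∈ Set.Icc 0 G) :
    0 < 1 + κ * v := by
  rcases le_or_gt 0 κ with h | h
  · nlinarith [mul_nonneg h hv.1]
  · nlinarith [hv.2]

theorem mul_expTransform {θ κ v : ℝ} (hθ : θ ≠ 0) :
    θ * expTransform θ κ v = Real.log (1 + κ * v) :=
  mul_div_cancel₀ _ hθ

theorem exp_mul_expTransform {θ κ v : ℝ} (hθ : θ ≠ 0) (h : 0 < 1 + κ * v) :
    Real.exp (θ * expTransform θ κ v) = 1 + κ * v := by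
  rw [mul_expTransform hθ, Real.exp_log h]

theorem exp_convex_comb_le {a b p : ℝ} (h0 : 0 ≤ p) (h1 : p ≤ 1) :
    Real.exp ((1 - p) * a + p * b) ≤ (1 - p) * Real.exp a + p * Real.exp b := by
  have := convexOn_exp.2 (Set.mem_univ a) (Set.mem_univ b) (sub_nonneg.2 h1) h0 (by ring)
  simpa [smul_eq_mul] using this

namespace DiscountedMDP

variable {S A : Type*} [MeasurableSpace S] [Fintype S] [MeasurableSingletonClass S]
  (M : DiscountedMDP S A)

theorem lintegral_exp_le (s : S) (a : A) {W : S × ℝ → ℝ} {b : ℝ} {F : S → ℝ}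
    (h : ∀ᵐ z ∂(M.step s a), Real.exp (W z) ≤ b * z.2 + F z.1) :
    ∫⁻ z, ENNReal.ofReal (Real.exp (W z)) ∂(M.step s a)
      ≤ ENNReal.ofReal (b * M.r s a + ∑ s', M.P s a s' * F s') := by
  have := M.step_prob s a
  have hF : Measurable F := measurable_of_finite F
  have i1 : Integrable (fun z : S × ℝ => z.2) (M.step s a) :=
    Integrable.of_bound measurable_snd.aestronglyMeasurable M.Rmax
      ((M.reward_mem s a).mono fun z hz => by
        rw [Real.norm_eq_abs, abs_of_nonneg hz.1]; exact hz.2)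
  have i2 : Integrable (fun z : S × ℝ => F z.1) (M.step s a) := by
    have : Integrable F ((M.step s a).map Prod.fst) := Integrable.of_finite
    exact this.comp_measurable measurable_fst
  have e2 : ∫ z, F z.1 ∂(M.step s a) = ∑ s', M.P s a s' * F s' := by
    have hp : IsProbabilityMeasure ((M.step s a).map Prod.fst) :=
      Measure.isProbabilityMeasure_map measurable_fst.aemeasurable
    rw [← integral_map (f := F) measurable_fst.aemeasurable hF.aestronglyMeasurable,
      integral_fintype Integrable.of_finite]
    refine sum_congr rfl fun x _ => ?_
    rw [map_measureReal_apply measurable_fst (measurableSet_singleton x), smul_eq_mul]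
    rfl
  calc ∫⁻ z, ENNReal.ofReal (Real.exp (W z)) ∂(M.step s a)
      ≤ ∫⁻ z, ENNReal.ofReal (b * z.2 + F z.1) ∂(M.step s a) :=
        lintegral_mono_ae (h.mono fun z hz => ENNReal.ofReal_le_ofReal hz)
    _ = ENNReal.ofReal (∫ z, (b * z.2 + F z.1) ∂(M.step s a)) := by
        refine (ofReal_integral_eq_lintegral_ofReal ((i1.const_mul b).add i2) ?_).symm
        exact h.mono fun z hz => (Real.exp_pos _).le.trans hz
    _ = _ := by rw [integral_add (i1.const_mul b) i2, integral_const_mul, e2]; rfl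

/-- Exponential moment of the transformed one-step return. -/
theorem lintegral_exp_expTransform_le (s : S) (a : A) {V : S → ℝ}
    (hV : ∀ s, V s ∈ Set.Icc 0 M.Vmax) {θ κ : ℝ} (hθ : θ ≠ 0)
    (hκ : Real.exp (θ * M.Vmax) ≤ 1 + κ * M.Vmax) :
    ∫⁻ z, ENNReal.ofReal (Real.exp (θ * (max 0 (min z.2 M.Rmax)
        + M.γ * expTransform θ κ (V z.1)))) ∂(M.step s a)
      ≤ ENNReal.ofReal (1 + κ * M.lookahead V s a) := by
  have hpos := (Real.exp_pos _).trans_le hκ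
  refine (M.lintegral_exp_le s a (b := κ) (F := fun s' => 1 + κ * M.γ * V s')
    ((M.reward_mem s a).mono fun z hz => ?_)).trans_eq ?_
  · rw [min_eq_left hz.2, max_eq_right hz.1]
    set ρ := z.2 / M.Rmax with hρ
    -- The reward is (1-γ) times a fraction ρ of `M.Vmax`, so reward + γT(V) is a convex combination
    -- with weights 1-γ and γ. Convexity of exp is applied once to it and once to ρ.
    have hz2 : z.2 = (1 - M.γ) * (ρ * M.Vmax) := by
      rw [mul_left_comm, ← M.Rmax_eq, hρ, div_mul_cancel₀ _ M.Rmax_pos.ne']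
    have hρ0 : 0 ≤ ρ := div_nonneg hz.1 M.Rmax_pos.le
    have hρ1 : ρ ≤ 1 := div_le_one_of_le₀ hz.2 M.Rmax_pos.le
    have e1 : Real.exp (θ * (ρ * M.Vmax)) ≤ 1 + κ * (ρ * M.Vmax) := by
      have h := exp_convex_comb_le (a := 0) (b := θ * M.Vmax) hρ0 hρ1
      rw [Real.exp_zero] at h
      rw [show θ * (ρ * M.Vmax) = (1 - ρ) * 0 + ρ * (θ * M.Vmax) by ring]
      nlinarith [mul_le_mul_of_nonneg_left hκ hρ0]
    have e2 := exp_mul_expTransform hθ (one_add_mul_pos hpos (hV z.1))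
    have e3 := exp_convex_comb_le (a := θ * (ρ * M.Vmax))
      (b := θ * expTransform θ κ (V z.1)) M.γ_nonneg M.γ_lt_one.le
    rw [e2] at e3
    rw [show θ * (z.2 + M.γ * expTransform θ κ (V z.1)) = (1 - M.γ) * (θ * (ρ * M.Vmax))
      + M.γ * (θ * expTransform θ κ (V z.1)) by rw [hz2]; ring]
    refine e3.trans ((add_le_add_left
      (mul_le_mul_of_nonneg_left e1 M.one_sub_γ_pos.le) _).trans_eq ?_)
    rw [hz2]
    ring
  · simp only [mul_add, sum_add_distrib, mul_one, M.sum_P, lookahead]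
    rw [mul_sum, mul_sum]
    congr 1
    have : ∀ x, M.P s a x * (κ * M.γ * V x) = κ * (M.γ * (M.P s a x * V x)) := fun x => by ring
    simp only [this]
    ring

/-- The Bernoulli moment 1 + p(exp x - 1) is at most the Poisson moment exp(p(exp x - 1)). -/
theorem lintegral_exp_indicator_le [DecidableEq S] (s : S) (a : A) (s' : S) (x : ℝ) :
    ∫⁻ z, ENNReal.ofReal (Real.exp (x * if z.1 = s' then 1 else 0)) ∂(M.step s a)
      ≤ ENNReal.ofReal (Real.exp (M.P s a s' * (Real.exp x - 1))) := by
  refine (M.lintegral_exp_le s a (b := 0)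
    (F := fun y => 1 + if y = s' then Real.exp x - 1 else 0) (ae_of_all _ fun z => ?_)).trans ?_
  · by_cases hz : z.1 = s' <;> simp [hz]
  · refine ENNReal.ofReal_le_ofReal ?_
    simp only [mul_add, sum_add_distrib, mul_one, M.sum_P, mul_ite, mul_zero, sum_ite_eq',
      mem_univ, if_true, zero_mul, zero_add]
    rw [add_comm]
    exact Real.add_one_le_exp _

theorem lookahead_mem {V : S → ℝ} (hV : ∀ s, V s ∈ Set.Icc 0 M.Vmax) (s : S) (a : A) :
    M.lookahead V s a ∈ Set.Icc 0 M.Vmax := by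
  refine ⟨M.lookahead_nonneg (fun s => (hV s).1) s a, ?_⟩
  have h : ∑ s', M.P s a s' * V s' ≤ ∑ s', M.P s a s' * M.Vmax :=
    sum_le_sum fun x _ => mul_le_mul_of_nonneg_left (hV x).2 (M.P_nonneg s a x)
  rw [← sum_mul, M.sum_P, one_mul] at h
  have h1 := M.r_le s a
  rw [M.Rmax_eq] at h1
  unfold lookahead
  nlinarith [mul_le_mul_of_nonneg_left h M.γ_nonneg]

end DiscountedMDP

namespace EUBRL.IsRun

variable {S A Ω : Type*} [MeasurableSpace S] [Fintype S] [Fintype A] [DecidableEq S]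
  [DecidableEq A] [Nonempty A] [MeasurableSpace A] [MeasurableSingletonClass S]
  [MeasurableSingletonClass A] {mΩ : MeasurableSpace Ω}
  {M : DiscountedMDP S A} {Emax : ℝ} {lam ell : ℕ → ℝ}
  {μ : Measure Ω} [IsProbabilityMeasure μ] {ℱ : Filtration ℕ mΩ} {state : ℕ → Ω → S}
  {reward : ℕ → Ω → ℝ} {policy : ℕ → Ω → S → A}
  (hrun : IsRun M Emax lam ell μ ℱ state reward policy)
include hrun

theorem measure_return_deviation_le (s : S) (a : A) {V : S → ℝ}
    (hV : ∀ s, V s ∈ Set.Icc 0 M.Vmax) {θ κ : ℕ → ℝ} (hθ : ∀ j, θ j ≠ 0)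
    (hκ : ∀ j, Real.exp (θ j * M.Vmax) ≤ 1 + κ j * M.Vmax) {ε : ℝ} (hε : 0 < ε) :
    μ {ω | (∀ t, reward t ω ∈ Set.Icc 0 M.Rmax) ∧ ∃ (j : ℕ) (t : ℕ),
      Real.log ((j + 1) * (j + 2) / ε) ≤ (traj state reward policy ω).N t s a *
        (θ j * ((traj state reward policy ω).rhat t s a
          + M.γ * ∑ s', (traj state reward policy ω).Phat t s a s' *
              expTransform (θ j) (κ j) (V s')
          - expTransform (θ j) (κ j) (M.lookahead V s a)))} ≤ ENNReal.ofReal ε := by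
  refine (measure_mono ?_).trans (hrun.measure_exists_seq_visit_sum_le s a
    (W := fun j z => θ j * (max 0 (min z.2 M.Rmax) + M.γ * expTransform (θ j) (κ j) (V z.1)))
    (c := fun j => Real.log (1 + κ j * M.lookahead V s a)) (fun j => ?_) (fun j => ?_) hε)
  · rintro ω ⟨hr, j, t, h⟩
    refine ⟨j, t, h.trans_eq ?_⟩
    set T := traj state reward policy ω with hT
    have e0 : ∀ τ, max 0 (min (reward τ ω) M.Rmax) = reward τ ω := fun τ => by
      rw [min_eq_left (hr τ).2, max_eq_right (hr τ).1]
    simp only [e0, sum_sub_distrib, sum_const, nsmul_eq_mul, ← mul_sum, sum_add_distrib]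
    have e1 := T.N_mul_rhat t s a
    have e2 := T.N_mul_sum_Phat t s a fun s' => expTransform (θ j) (κ j) (V s')
    change _ = ∑ τ ∈ T.visitTimes t s a, reward τ ω at e1
    change _ = ∑ τ ∈ T.visitTimes t s a, expTransform (θ j) (κ j) (V (state (τ + 1) ω)) at e2
    rw [← e1, ← e2, ← mul_expTransform (hθ j)]
    change _ = _ - (T.N t s a : ℝ) * _
    ring
  · have h1 : Measurable fun s' => expTransform (θ j) (κ j) (V s') := measurable_of_finite _
    have h2 : Measurable fun z : S × ℝ => expTransform (θ j) (κ j) (V z.1) :=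
      h1.comp measurable_fst
    exact (((measurable_const.max (measurable_snd.min measurable_const))).add
      (h2.const_mul _)).const_mul _
  · refine (M.lintegral_exp_expTransform_le s a hV (hθ j) (hκ j)).trans_eq ?_
    rw [Real.exp_log (one_add_mul_pos ((Real.exp_pos _).trans_le (hκ j)) (M.lookahead_mem hV s a))]

theorem measure_transition_deviation_le (s : S) (a : A) (s' : S) (x : ℕ → ℝ) {ε : ℝ}
    (hε : 0 < ε) :
    μ {ω | ∃ (j : ℕ) (t : ℕ), Real.log ((j + 1) * (j + 2) / ε) ≤
      (traj state reward policy ω).N t s a * (x j * (traj state reward policy ω).Phat t s a s'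
        - M.P s a s' * (Real.exp (x j) - 1))} ≤ ENNReal.ofReal ε := by
  refine (measure_mono ?_).trans (hrun.measure_exists_seq_visit_sum_le s a
    (W := fun j z => x j * if z.1 = s' then 1 else 0) (fun j => ?_)
    (fun j => M.lintegral_exp_indicator_le s a s' (x j)) hε)
  · rintro ω ⟨j, t, h⟩
    refine ⟨j, t, h.trans_eq ?_⟩
    set T := traj state reward policy ω with hT
    simp only [sum_sub_distrib, sum_const, nsmul_eq_mul, ← mul_sum]
    have e1 := T.N_mul_Phat t s a s'
    change _ = ∑ τ ∈ T.visitTimes t s a, if state (τ + 1) ω = s' then (1 : ℝ) else 0 at e1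
    rw [← e1]
    change _ = _ - (T.N t s a : ℝ) * _
    ring
  · exact (Measurable.ite (measurable_fst (measurableSet_singleton s')) measurable_const
      measurable_const).const_mul _

end EUBRL.IsRun

/-! ### Distance of the transforms from the identity. -/

theorem exp_neg_le_one_sub_add_sq {x : ℝ} (hx : 0 ≤ x) : Real.exp (-x) ≤ 1 - x + x ^ 2 / 2 := by
  have h1 := Real.quadratic_le_exp_of_nonneg hx
  have h2 : Real.exp x * Real.exp (-x) = 1 := by rw [← Real.exp_add]; simp
  have h3 := Real.exp_pos (-x)
  have h4 : (1 + x + x ^ 2 / 2) * Real.exp (-x) ≤ 1 :=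
    (mul_le_mul_of_nonneg_right h1 h3.le).trans_eq h2
  -- The product is at least 1, so 1 - x + x²/2 dominates the reciprocal of a lower bound for exp x.
  have h5 : (1 + x + x ^ 2 / 2) * (1 - x + x ^ 2 / 2) = 1 + x ^ 4 / 4 := by ring
  have h6 : 0 < 1 + x + x ^ 2 / 2 := by positivity
  refine le_of_mul_le_mul_left (h4.trans ?_) h6
  rw [h5]
  have : 0 ≤ x ^ 4 := by positivity
  linarith

theorem exp_le_one_add_add_sq {x : ℝ} (h0 : 0 ≤ x) (h1 : x ≤ 1) : Real.exp x ≤ 1 + x + x ^ 2 := by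
  have := Real.abs_exp_sub_one_sub_id_le (x := x) (by rwa [abs_of_nonneg h0])
  linarith [(abs_le.1 this).2]

theorem inv_one_sub_le_exp {x : ℝ} (h0 : 0 ≤ x) (h1 : x ≤ 2 / 5) :
    (1 - x)⁻¹ ≤ Real.exp (x + x ^ 2) := by
  have h := Real.quadratic_le_exp_of_nonneg (x := x + x ^ 2) (by positivity)
  refine le_trans ?_ h
  rw [inv_le_iff_one_le_mul₀ (by linarith)]
  nlinarith [mul_nonneg (sq_nonneg x) (sub_nonneg.2 h1),
    mul_nonneg (pow_nonneg h0 3) (sub_nonneg.2 h1),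
    mul_nonneg (pow_nonneg h0 4) (sub_nonneg.2 h1), pow_nonneg h0 2,
    pow_nonneg h0 3, pow_nonneg h0 4]

/-- Coefficient of the transform used for lower deviations. -/
noncomputable def lowerCoeff (θ G : ℝ) : ℝ := -(θ * (1 - θ * G / 2))

/-- Coefficient of the transform used for upper deviations. -/
noncomputable def upperCoeff (θ G : ℝ) : ℝ := θ / (1 - θ * G)

section Transform

variable {θ G v : ℝ}

theorem exp_le_lowerCoeff (hθ : 0 ≤ θ) (hG : 0 ≤ G) :
    Real.exp (-θ * G) ≤ 1 + lowerCoeff θ G * G := by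
  have := exp_neg_le_one_sub_add_sq (mul_nonneg hθ hG)
  rw [← neg_mul] at this
  refine this.trans_eq ?_
  unfold lowerCoeff
  ring

theorem one_add_upperCoeff_mul (h1 : θ * G < 1) : 1 + upperCoeff θ G * G = (1 - θ * G)⁻¹ := by
  have : 1 - θ * G ≠ 0 := by linarith
  unfold upperCoeff
  field_simp
  ring

theorem exp_le_upperCoeff (h1 : θ * G < 1) : Real.exp (θ * G) ≤ 1 + upperCoeff θ G * G := by
  rw [one_add_upperCoeff_mul h1, le_inv_comm₀ (Real.exp_pos _) (by linarith), ← Real.exp_neg]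
  linarith [Real.add_one_le_exp (-(θ * G))]

theorem sub_le_expTransform_lower (hθ : 0 < θ) (hv : v ∈ Set.Icc 0 G) :
    v - θ * G * G / 2 ≤ expTransform (-θ) (lowerCoeff θ G) v := by
  have hG : 0 ≤ G := hv.1.trans hv.2
  have hpos : 0 < 1 + lowerCoeff θ G * v :=
    one_add_mul_pos ((Real.exp_pos _).trans_le (exp_le_lowerCoeff hθ.le hG)) hv
  have h2 := Real.log_le_sub_one_of_pos hpos
  have h3 : θ * (v - θ * G * G / 2) ≤ -Real.log (1 + lowerCoeff θ G * v) := by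
    have h4 : θ * (v - θ * G * G / 2) ≤ -(lowerCoeff θ G * v) := by
      unfold lowerCoeff
      nlinarith [mul_nonneg (mul_nonneg hθ.le (mul_nonneg hθ.le hG)) (sub_nonneg.2 hv.2)]
    linarith
  unfold expTransform
  rw [div_neg, ← neg_div, le_div_iff₀ hθ]
  linarith

/-- Keeps the transformed value below the truncation level, as needed where the agent's value is
truncated. -/
theorem expTransform_lower_le (hθ : 0 < θ) (h1 : θ * G ≤ 1) (hv : v ∈ Set.Icc 0 G) :
    expTransform (-θ) (lowerCoeff θ G) v ≤ G := by
  have hG : 0 ≤ G := hv.1.trans hv.2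
  have h2 : Real.exp (-θ * G) ≤ 1 + lowerCoeff θ G * v := by
    refine (exp_le_lowerCoeff hθ.le hG).trans ?_
    have : lowerCoeff θ G ≤ 0 := by unfold lowerCoeff; nlinarith
    nlinarith [hv.2]
  have h3 := (Real.le_log_iff_exp_le ((Real.exp_pos _).trans_le h2)).2 h2
  unfold expTransform
  rw [div_neg, ← neg_div, div_le_iff₀ hθ]
  linarith

/-- The slope κ/(θ(1 + κv)) decreases in v and equals 1 at v = G, so the transform expands distances
on [0, G]. This preserves suboptimality gaps. -/
theorem sub_le_expTransform_upper_sub (hθ : 0 < θ) (h1 : θ * G < 1) {u : ℝ} (hu : 0 ≤ u)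
    (huv : u ≤ v) (hv : v ≤ G) :
    v - u ≤ expTransform θ (upperCoeff θ G) v - expTransform θ (upperCoeff θ G) u := by
  have hκ : 0 ≤ upperCoeff θ G := div_nonneg hθ.le (by linarith)
  set κ := upperCoeff θ G with hκd
  have hκG : κ * (1 - θ * G) = θ := div_mul_cancel₀ _ (by linarith)
  have pu : 0 < 1 + κ * u := by positivity
  have pv : 0 < 1 + κ * v := by nlinarith
  have h2 := Real.one_sub_inv_le_log_of_pos (div_pos pv pu)
  rw [Real.log_div pv.ne' pu.ne', inv_div] at h2
  have h3 : θ * (v - u) ≤ 1 - (1 + κ * u) / (1 + κ * v) := by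
    rw [one_sub_div pv.ne', le_div_iff₀ pv]
    have : θ * (1 + κ * v) ≤ κ := by
      have h5 : θ * (1 + κ * G) = κ := by
        rw [one_add_upperCoeff_mul h1, hκd]; rfl
      refine le_trans ?_ h5.le
      gcongr
    nlinarith
  unfold expTransform
  rw [← sub_div, le_div_iff₀ hθ]
  linarith

theorem le_expTransform_upper (hθ : 0 < θ) (h1 : θ * G < 1) (hv : v ∈ Set.Icc 0 G) :
    v ≤ expTransform θ (upperCoeff θ G) v := by
  have := sub_le_expTransform_upper_sub hθ h1 le_rfl hv.1 hv.2
  simpa [expTransform] using this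

theorem expTransform_upper_le (hθ : 0 < θ) (h1 : θ * G ≤ 2 / 5) (hv : v ∈ Set.Icc 0 G) :
    expTransform θ (upperCoeff θ G) v ≤ v + θ * G * G := by
  have hG : 0 ≤ G := hv.1.trans hv.2
  have h2 := sub_le_expTransform_upper_sub hθ (by linarith) hv.1 hv.2 le_rfl
  have h3 : expTransform θ (upperCoeff θ G) G ≤ G + θ * G * G := by
    unfold expTransform
    rw [div_le_iff₀ hθ, one_add_upperCoeff_mul (by linarith),
      Real.log_le_iff_le_exp (inv_pos.2 (by linarith))]
    refine (inv_one_sub_le_exp (by positivity) h1).trans_eq ?_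
    congr 1
    ring
  linarith

end Transform

/-! ### From single transition entries to averages, and the exponentiated recursion. -/

/-- Duality between exponential deviation bounds for the single weights and averages. -/
theorem sum_mul_le_log_sum_mul_exp {S : Type*} [Fintype S] {p q f : S → ℝ} {c : ℝ}
    (hq : ∀ i, 0 ≤ q i) (hq1 : ∑ i, q i = 1) (hp1 : ∑ i, p i = 1) (hf : ∀ i, |f i| ≤ 1 / 2)
    (h : ∀ i x, |x| ≤ 1 → p i * x ≤ q i * (Real.exp x - 1) + c) :
    ∑ i, p i * f i ≤ Real.log (∑ i, q i * Real.exp (f i)) + Fintype.card S * c := by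
  have lo : Real.exp (-(1 / 2)) ≤ ∑ i, q i * Real.exp (f i) := by
    calc Real.exp (-(1 / 2)) = ∑ i, q i * Real.exp (-(1 / 2)) := by rw [← sum_mul, hq1, one_mul]
      _ ≤ _ := sum_le_sum fun i _ =>
        mul_le_mul_of_nonneg_left (Real.exp_le_exp.2 (abs_le.1 (hf i)).1) (hq i)
  have hi : ∑ i, q i * Real.exp (f i) ≤ Real.exp (1 / 2) := by
    calc ∑ i, q i * Real.exp (f i) ≤ ∑ i, q i * Real.exp (1 / 2) := sum_le_sum fun i _ =>
          mul_le_mul_of_nonneg_left (Real.exp_le_exp.2 (abs_le.1 (hf i)).2) (hq i)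
      _ = _ := by rw [← sum_mul, hq1, one_mul]
  have hpos := (Real.exp_pos _).trans_le lo
  set m := Real.log (∑ i, q i * Real.exp (f i)) with hm
  have hm1 : -(1 / 2) ≤ m := (Real.le_log_iff_exp_le hpos).2 lo
  have hm2 : m ≤ 1 / 2 := (Real.log_le_iff_le_exp hpos).2 hi
  -- Centring by m = log ∑ q exp f makes ∑ q(exp(f - m) - 1) vanish, and |f|, |m| ≤ 1/2 keeps the
  -- arguments in [-1, 1].
  have e1 : ∑ i, p i * (f i - m) ≤ ∑ i, (q i * (Real.exp (f i - m) - 1) + c) :=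
    sum_le_sum fun i _ => h i _ (by
      obtain ⟨h1, h2⟩ := abs_le.1 (hf i)
      exact abs_le.2 ⟨by linarith, by linarith⟩)
  have e2 : ∑ i, (q i * (Real.exp (f i - m) - 1) + c) = Fintype.card S * c := by
    have e3 : ∀ i, q i * (Real.exp (f i - m) - 1) + c
        = (q i * Real.exp (f i)) * Real.exp (-m) - q i + c := fun i => by
      rw [sub_eq_add_neg (f i), Real.exp_add]; ring
    simp only [e3, sum_add_distrib, sum_sub_distrib, ← sum_mul, hq1, sum_const, nsmul_eq_mul]
    rw [Real.exp_neg, hm, Real.exp_log hpos, mul_inv_cancel₀ hpos.ne']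
    simp
  rw [e2] at e1
  simp only [mul_sub, sum_sub_distrib, ← sum_mul, hp1, one_mul] at e1
  linarith

/-- One step of the exponentiated recursion. -/
theorem exp_recursion_step {γ b u m d : ℝ} (hγ : 0 ≤ γ) (hγ1 : γ ≤ 1) (hb : 0 ≤ b)
    (hb1 : b ≤ 1 / 10) (hu : 0 ≤ u) (hu1 : u ≤ 1 / 12) (hm : -(7 / 60) ≤ m) (hm1 : m ≤ 1 / 12)
    (hd : d ≤ b - u + γ * m) :
    Real.exp d - 1 + 21 / 25 * u ≤ 7 / 5 * b + γ * (Real.exp m - 1) := by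
  set A := 1 + γ * (Real.exp m - 1) with hA
  -- A dominates exp(γm) and is linear in exp m. The ranges of m give 1 - 7/60 ≤ A ≤ 1 + 1/12 +
  -- 1/144.
  have hA0 : 53 / 60 ≤ A := by
    have := Real.add_one_le_exp m
    nlinarith
  have hA1 : A ≤ 157 / 144 := by
    have h1 := Real.exp_le_exp.2 hm1
    have h2 := exp_le_one_add_add_sq (x := 1 / 12) (by norm_num) (by norm_num)
    nlinarith
  have hexp : Real.exp (γ * m) ≤ A := by
    have := exp_convex_comb_le (a := 0) (b := m) hγ hγ1
    rw [mul_zero, zero_add, Real.exp_zero] at this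
    linarith
  have h1 : Real.exp d ≤ Real.exp b * Real.exp (-u) * A := by
    refine (Real.exp_le_exp.2 hd).trans ?_
    rw [Real.exp_add, sub_eq_add_neg, Real.exp_add]
    gcongr
  have h2 := exp_le_one_add_add_sq hb (by linarith)
  have h3 := exp_neg_le_one_sub_add_sq hu
  have h4 : Real.exp (-u) ≤ 1 := Real.exp_le_one_iff.2 (by linarith)
  have h5 : 1 ≤ Real.exp b := Real.one_le_exp hb
  have h6 : Real.exp b - 1 ≤ 11 / 10 * b := by nlinarith
  have h7 : 23 / 24 * u ≤ 1 - Real.exp (-u) := by nlinarith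
  -- The difference of the two sides is (exp b - 1)(1 - exp(-u)) ≥ 0.
  have h8 : Real.exp b * Real.exp (-u) - 1 ≤ (Real.exp b - 1) - (1 - Real.exp (-u)) := by nlinarith
  have h9 : A * (Real.exp b - 1) ≤ 7 / 5 * b := by nlinarith
  have h10 : 21 / 25 * u ≤ A * (1 - Real.exp (-u)) := by nlinarith
  have h11 : A * (Real.exp b * Real.exp (-u) - 1) ≤ A * ((Real.exp b - 1) - (1 - Real.exp (-u))) :=
    mul_le_mul_of_nonneg_left h8 (by linarith)
  nlinarith

/-! ### The bonus, the error term and the agent's value. -/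

namespace EUBRL

variable {S A : Type*} [MeasurableSpace S] [DecidableEq S] [DecidableEq A]

/-- Exploration bonus `P_U η E` at step `t`. -/
noncomputable def bonus (M : DiscountedMDP S A) (Emax : ℝ) (lam ell : ℕ → ℝ) (h : Trajectory S A)
    (t : ℕ) (s : S) (a : A) : ℝ :=
  h.PU Emax t s a * (eta M Emax lam ell t * h.epist Emax t s a)

variable {M : DiscountedMDP S A} {Emax : ℝ} {lam ell : ℕ → ℝ} {h : Trajectory S A} {t : ℕ}

omit [DecidableEq S] [DecidableEq A] in
theorem eta_eq (hlam : 0 < lam t) :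
    eta M Emax lam ell t = Emax * (7 * M.Vmax * ell t / lam t) + M.Vmax / lam t := by
  have hR := M.Rmax_pos
  have : √(m M lam t) = M.Vmax / (M.Rmax * lam t) := by
    have h0 : 0 ≤ M.Vmax / (M.Rmax * lam t) := by have := M.Vmax_pos; positivity
    rw [← Real.sqrt_sq h0, m, div_pow, mul_pow]
  rw [eta, this, Ups]
  congr 1
  field_simp

theorem bonus_eq (hE : 0 < Emax) (hlam : 0 < lam t) {s : S} {a : A} (hN : h.N t s a ≠ 0) :
    bonus M Emax lam ell h t s a
      = 7 * (M.Vmax * ell t / (lam t * h.N t s a)) + M.Vmax / (lam t * Emax * h.N t s a) := by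
  have hn : (0 : ℝ) < h.N t s a := by exact_mod_cast Nat.pos_of_ne_zero hN
  have hsq : √(h.N t s a : ℝ) * √(h.N t s a : ℝ) = h.N t s a := Real.mul_self_sqrt hn.le
  have hs : 0 < √(h.N t s a : ℝ) := Real.sqrt_pos.2 hn
  rw [bonus, Trajectory.PU, Trajectory.epist, if_neg hN, eta_eq hlam]
  generalize √(h.N t s a : ℝ) = y at hsq hs ⊢
  rw [← hsq]
  field_simp

theorem Vmax_le_bonus (hE : 1 ≤ Emax) (hlam : 0 < lam t) (hlam1 : lam t ≤ 1) (hell : 1 ≤ ell t)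
    {s : S} {a : A} (hN : h.N t s a = 0) : M.Vmax ≤ bonus M Emax lam ell h t s a := by
  have hG := M.Vmax_pos
  rw [bonus, Trajectory.PU, Trajectory.epist, if_pos hN, div_self (by linarith), one_mul,
    eta_eq hlam]
  have h1 : M.Vmax ≤ M.Vmax / lam t := le_div_self hG.le hlam hlam1
  have h2 : 0 ≤ Emax * (7 * M.Vmax * ell t / lam t) := by positivity
  nlinarith

omit [MeasurableSpace S] in
theorem PU_mem (hE : 1 ≤ Emax) (s : S) (a : A) : h.PU Emax t s a ∈ Set.Icc 0 1 := by
  have hle : h.epist Emax t s a ≤ Emax ∧ 0 ≤ h.epist Emax t s a := by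
    unfold Trajectory.epist
    split_ifs with h0
    · exact ⟨le_rfl, by linarith⟩
    · have : (1 : ℝ) ≤ √(h.N t s a : ℝ) := by
        rw [Real.one_le_sqrt]; exact_mod_cast Nat.one_le_iff_ne_zero.2 h0
      exact ⟨((div_le_one (by linarith)).2 this).trans hE, by positivity⟩
  exact ⟨div_nonneg hle.2 (by linarith), (div_le_one (by linarith)).2 hle.1⟩

omit [DecidableEq S] [DecidableEq A] in
theorem eta_nonneg (hE : 1 ≤ Emax) (hlam : 0 < lam t) (hell : 1 ≤ ell t) :
    0 ≤ eta M Emax lam ell t := by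
  have := M.Vmax_pos
  rw [eta_eq hlam]
  positivity

theorem bonus_nonneg (hE : 1 ≤ Emax) (hlam : 0 < lam t) (hell : 1 ≤ ell t) (s : S) (a : A) :
    0 ≤ bonus M Emax lam ell h t s a := by
  have h1 := PU_mem (h := h) (t := t) hE s a
  have h2 : h.epist Emax t s a = h.PU Emax t s a * Emax := by
    rw [Trajectory.PU, div_mul_cancel₀ _ (by linarith)]
  have := eta_nonneg (M := M) hE hlam hell
  rw [bonus, h2]
  have := h1.1
  positivity

/-- An inequality of arithmetic-geometric type. The factor 1 - `h.PU` costs at most this much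
reward: the first term is exactly the √m part of the bonus, and the second is the slack created by
shifting values by Φ. -/
theorem PU_mul_Rmax_le (hE : 1 ≤ Emax) (hlam : 0 < lam t) {s : S} {a : A} (hN : h.N t s a ≠ 0) :
    h.PU Emax t s a * M.Rmax
      ≤ M.Vmax / (lam t * Emax * h.N t s a) + (1 - M.γ) * (M.Rmax * lam t) := by
  have hn : (0 : ℝ) < h.N t s a := by exact_mod_cast Nat.pos_of_ne_zero hN
  have hsq : √(h.N t s a : ℝ) * √(h.N t s a : ℝ) = h.N t s a := Real.mul_self_sqrt hn.le
  have hs : 0 < √(h.N t s a : ℝ) := Real.sqrt_pos.2 hn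
  have hG := M.Vmax_pos
  have hγ := M.one_sub_γ_pos
  rw [Trajectory.PU, Trajectory.epist, if_neg hN]
  generalize √(h.N t s a : ℝ) = y at hsq hs ⊢
  rw [M.Rmax_eq, ← hsq]
  have hE0 : 0 < Emax := by linarith
  set p := 1 - M.γ
  have e1 : 1 / y / Emax * (p * M.Vmax) = M.Vmax * (y * p * lam t) / (lam t * Emax * (y * y)) := by
    field_simp
  have e2 : M.Vmax / (lam t * Emax * (y * y)) + p * (p * M.Vmax * lam t)
      = M.Vmax * (1 + Emax * (y * p * lam t) ^ 2) / (lam t * Emax * (y * y)) := by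
    field_simp
  rw [e1, e2]
  gcongr
  have : 0 ≤ (y * p * lam t) ^ 2 := sq_nonneg _
  nlinarith [sq_nonneg (y * p * lam t - 1)]

omit [MeasurableSpace S] in
theorem ell3_ge [Fintype S] [Fintype A] [Nonempty S] [Nonempty A] {δ : ℝ} (hδ : 0 < δ)
    (hδ1 : δ ≤ 1) (s : S) (a : A) : 1 ≤ ell3 δ h t s a := by
  have hS : (1 : ℝ) ≤ Fintype.card S := by exact_mod_cast Fintype.card_pos
  have hA : (1 : ℝ) ≤ Fintype.card A := by exact_mod_cast Fintype.card_pos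
  have hlog : 0 ≤ Real.log (h.N t s a) := Real.log_natCast_nonneg _
  unfold ell3
  rw [Real.le_log_iff_exp_le (by positivity)]
  have h1 : (12 : ℝ) ≤ 12 * Fintype.card S * Fintype.card A * (1 + Real.log (h.N t s a)) / δ := by
    rw [le_div_iff₀ hδ]
    have h2 : (1 : ℝ) ≤ Fintype.card S * Fintype.card A := one_le_mul_of_one_le_of_one_le hS hA
    have h3 : (1 : ℝ) ≤ Fintype.card S * Fintype.card A * (1 + Real.log (h.N t s a)) :=
      one_le_mul_of_one_le_of_one_le h2 (by linarith)
    linarith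
  linarith [Real.exp_one_lt_d9]

variable [Fintype S] [Fintype A]

theorem beta_eq {δ : ℝ} {s : S} {a : A} (hN : h.N t s a ≠ 0) :
    beta M Emax lam ell δ h t s a = bonus M Emax lam ell h t s a
      + (4 - h.PU Emax t s a) * (M.Vmax * ell t / (lam t * h.N t s a))
      + 30 * (M.Vmax * Fintype.card S * ell3 δ h t s a / h.N t s a) := by
  rw [beta, if_neg hN, bonus]
  have hn : (h.N t s a : ℝ) ≠ 0 := Nat.cast_ne_zero.2 hN
  rcases eq_or_ne (lam t) 0 with h0 | h0
  · simp [h0]; ring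
  · field_simp
    ring

theorem le_beta {δ : ℝ} (hE : 1 ≤ Emax) (hlam : 0 < lam t)
    (hell : 1 ≤ ell t) {s : S} {a : A} (hN : h.N t s a ≠ 0) :
    bonus M Emax lam ell h t s a + 3 * (M.Vmax * ell t / (lam t * h.N t s a))
      + 30 * (M.Vmax * Fintype.card S * ell3 δ h t s a / h.N t s a)
      ≤ beta M Emax lam ell δ h t s a := by
  have hG := M.Vmax_pos
  have h1 : 0 ≤ M.Vmax * ell t / (lam t * h.N t s a) := by positivity
  rw [beta_eq hN]
  nlinarith [(PU_mem (h := h) (t := t) hE s a).2]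

theorem J_eq [MeasurableSingletonClass S] (δ : ℝ) (π : S → A) (s : S) :
    J M Emax lam ell δ h t π s = min (beta M Emax lam ell δ h t s (π s)
      + M.γ * ∑ s', M.P s (π s) s' * J M Emax lam ell δ h t π s') M.Vmax :=
  (congrFun (ContractingWith.fixedPoint_isFixedPt (clippedEval_contracting M.γ_nonneg M.γ_lt_one
    M.Vmax (beta M Emax lam ell δ h t) M.P_nonneg (fun s a => (M.sum_P s a).le) π)) s).symm

variable [Nonempty A]

theorem agentValue_eq (s : S) : agentValue M Emax lam ell h t s
    = clippedOpt M.γ M.Vmax (guidedReward M Emax lam ell h t) (h.Phat t)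
      (agentValue M Emax lam ell h t) s :=
  (congrFun (ContractingWith.fixedPoint_isFixedPt (clippedOpt_contracting M.γ_nonneg M.γ_lt_one
    M.Vmax (guidedReward M Emax lam ell h t) (h.Phat_nonneg t) (h.sum_Phat_le t))) s).symm

theorem min_le_agentValue (s : S) (a : A) :
    min (guidedReward M Emax lam ell h t s a
      + M.γ * ∑ s', h.Phat t s a s' * agentValue M Emax lam ell h t s') M.Vmax
      ≤ agentValue M Emax lam ell h t s := by
  conv_rhs => rw [agentValue_eq]
  exact le_sup' (fun a => clippedQ M.γ M.Vmax (guidedReward M Emax lam ell h t) (h.Phat t)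
    (agentValue M Emax lam ell h t) s a) (mem_univ a)

theorem agentValue_le_Vmax (s : S) : agentValue M Emax lam ell h t s ≤ M.Vmax := by
  rw [agentValue_eq]
  exact sup'_le _ _ fun a _ => min_le_right _ _

theorem agentValue_nonneg (hE : 1 ≤ Emax) (hlam : 0 < lam t) (hell : 1 ≤ ell t)
    (hr : ∀ t, h.reward t ∈ Set.Icc 0 M.Rmax) (s : S) : 0 ≤ agentValue M Emax lam ell h t s := by
  let a : A := Classical.arbitrary A
  have := nonpos_of_le_discounted_sum M.γ_nonneg M.γ_lt_one (K := fun s s' => h.Phat t s a s')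
    (fun s s' => h.Phat_nonneg _ _ _ _) (fun s => h.sum_Phat_le t s a)
    (f := fun s => -agentValue M Emax lam ell h t s) (fun x hx => by
      have h1 := min_le_agentValue (M := M) (Emax := Emax) (lam := lam) (ell := ell) (h := h)
        (t := t) x a
      have h2 : 0 ≤ guidedReward M Emax lam ell h t x a :=
        add_nonneg (mul_nonneg (sub_nonneg.2 (PU_mem hE x a).2)
            (h.rhat_mem M.Rmax_pos.le hr t x a).1)
          (bonus_nonneg hE hlam hell x a)
      simp only [mul_neg, sum_neg_distrib]
      rcases min_le_iff.1 h1 with h3 | h3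
      · linarith
      · linarith [M.Vmax_pos]) s
  linarith

variable [Nonempty S]

theorem beta_nonneg {δ : ℝ} (hE : 1 ≤ Emax) (hδ : 0 < δ) (hδ1 : δ ≤ 1) (hlam : 0 < lam t)
    (hell : 1 ≤ ell t) (s : S) (a : A) : 0 ≤ beta M Emax lam ell δ h t s a := by
  have hG := M.Vmax_pos
  by_cases hN : h.N t s a = 0
  · rw [beta, if_pos hN]; exact hG.le
  · refine le_trans ?_ (le_beta hE hlam hell hN)
    have := bonus_nonneg (M := M) (h := h) hE hlam hell s a
    have := ell3_ge (h := h) (t := t) hδ hδ1 s a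
    positivity

variable [MeasurableSingletonClass S]

theorem J_nonneg {δ : ℝ} (hE : 1 ≤ Emax) (hδ : 0 < δ) (hδ1 : δ ≤ 1) (hlam : 0 < lam t)
    (hell : 1 ≤ ell t) (π : S → A) (s : S) : 0 ≤ J M Emax lam ell δ h t π s := by
  have := nonpos_of_le_discounted_sum M.γ_nonneg M.γ_lt_one (K := fun s s' => M.P s (π s) s')
    (fun s s' => M.P_nonneg _ _ _) (fun s => (M.sum_P s (π s)).le)
    (f := fun s => -J M Emax lam ell δ h t π s) (fun x hx => by
      have h1 := J_eq (M := M) (Emax := Emax) (lam := lam) (ell := ell) (h := h) (t := t) δ π x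
      have h2 := beta_nonneg (M := M) (h := h) hE hδ hδ1 hlam hell x (π x)
      simp only [mul_neg, sum_neg_distrib]
      rcases min_choice (beta M Emax lam ell δ h t x (π x)
        + M.γ * ∑ s', M.P x (π x) s' * J M Emax lam ell δ h t π s') M.Vmax with h3 | h3
      · rw [h3] at h1; linarith
      · rw [h3] at h1; linarith [M.Vmax_pos]) s
  linarith

/-- Where the error term alone reaches the truncation level, nonnegativity of J makes the truncation
active. -/
theorem J_eq_Vmax_of_le_beta {δ : ℝ} (hE : 1 ≤ Emax) (hδ : 0 < δ) (hδ1 : δ ≤ 1) (hlam : 0 < lam t)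
    (hell : 1 ≤ ell t) {π : S → A} {s : S} (hb : M.Vmax ≤ beta M Emax lam ell δ h t s (π s)) :
    J M Emax lam ell δ h t π s = M.Vmax := by
  rw [J_eq, min_eq_right]
  exact hb.trans (le_add_of_nonneg_right (mul_nonneg M.γ_nonneg (sum_nonneg fun x _ =>
    mul_nonneg (M.P_nonneg _ _ _) (J_nonneg hE hδ hδ1 hlam hell π x))))

end EUBRL

/-! ### Deterministic regret bound under concentration. -/

namespace EUBRL

variable {S A : Type*} [MeasurableSpace S] [Fintype S] [DecidableEq S] [DecidableEq A]
  [Fintype A]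

/-- The deviation bounds at step `t` from which the regret bound follows deterministically; `θ` is
the exponential tilt of the return deviations and `L` the confidence level of these. -/
structure IsConcentrated (M : DiscountedMDP S A) (lam ell : ℕ → ℝ) (δ : ℝ) (h : Trajectory S A)
    (t : ℕ) (θ L : ℝ) : Prop where
  tilt_pos : 0 < θ
  tilt_le : θ * M.Vmax ≤ 2 / 5
  tilt_le_lam : θ * M.Vmax ≤ 3 / 5 * lam t
  level_le : L * lam t ≤ 5 * ell t * (θ * M.Vmax)
  reward_mem : ∀ t, h.reward t ∈ Set.Icc 0 M.Rmax
  lower : ∀ s a, h.N t s a * (-θ * (h.rhat t s a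
    + M.γ * ∑ s', h.Phat t s a s' * expTransform (-θ) (lowerCoeff θ M.Vmax) (M.optValue s')
    - expTransform (-θ) (lowerCoeff θ M.Vmax) (M.lookahead M.optValue s a))) ≤ L
  upper : ∀ s a, h.N t s a * (θ * (h.rhat t s a
    + M.γ * ∑ s', h.Phat t s a s' * expTransform θ (upperCoeff θ M.Vmax) (M.optValue s')
    - expTransform θ (upperCoeff θ M.Vmax) (M.lookahead M.optValue s a))) ≤ L
  transition : ∀ s a s' x, |x| ≤ 1 →
    h.N t s a * (x * h.Phat t s a s' - M.P s a s' * (Real.exp x - 1)) ≤ 3 * ell3 δ h t s a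

variable {M : DiscountedMDP S A} {Emax : ℝ} {lam ell : ℕ → ℝ} {h : Trajectory S A} {t : ℕ}
  {δ θ L : ℝ}

theorem le_of_mul_mul_le {n θ G lam L ell d : ℝ} (hn : 0 < n) (hθ : 0 < θ) (hlam : 0 < lam)
    (hL : L * lam ≤ 5 * ell * (θ * G)) (hd : n * (θ * d) ≤ L) :
    d ≤ 5 * (G * ell / (lam * n)) := by
  rw [← mul_div_assoc, le_div_iff₀ (by positivity)]
  refine le_of_mul_le_mul_left ?_ hθ
  nlinarith [mul_le_mul_of_nonneg_right hd hlam.le]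

section

variable [MeasurableSingletonClass S] [Nonempty A]

omit [DecidableEq A] in
theorem optValue_mem (M : DiscountedMDP S A) (s : S) : M.optValue s ∈ Set.Icc 0 M.Vmax :=
  ⟨M.optValue_nonneg s, M.optValue_le_Vmax s⟩

/-- Quasi-optimism of the agent. -/
theorem IsConcentrated.optimism (hc : IsConcentrated M lam ell δ h t θ L) (hE : 1 ≤ Emax)
    (hlam : 0 < lam t) (hlam1 : lam t ≤ 1) (hell : 1 ≤ ell t) {πstar : S → A}
    (hopt : M.IsOptimal πstar) (s : S) :
    expTransform (-θ) (lowerCoeff θ M.Vmax) (M.optValue s) - M.Rmax * lam t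
      ≤ agentValue M Emax lam ell h t s := by
  have hG := M.Vmax_pos
  have hΦ : 0 < M.Rmax * lam t := mul_pos M.Rmax_pos hlam
  set g : S → ℝ := fun s => expTransform (-θ) (lowerCoeff θ M.Vmax) (M.optValue s) with hg
  have hgG : ∀ s, g s ≤ M.Vmax := fun s =>
    expTransform_lower_le hc.tilt_pos (by linarith [hc.tilt_le]) (optValue_mem M s)
  have := nonpos_of_le_discounted_sum M.γ_nonneg M.γ_lt_one
    (K := fun s s' => h.Phat t s (πstar s) s')
    (fun s s' => h.Phat_nonneg _ _ _ _) (fun s => h.sum_Phat_le t s (πstar s))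
    (f := fun s => g s - M.Rmax * lam t - agentValue M Emax lam ell h t s) (fun x hx => by
      have h1 := min_le_agentValue (M := M) (Emax := Emax) (lam := lam) (ell := ell) (h := h)
        (t := t) x (πstar x)
      have h2 := hgG x
      rcases min_le_iff.1 h1 with h3 | h3
      swap
      · linarith
      have hrew : guidedReward M Emax lam ell h t x (πstar x) = (1 - h.PU Emax t x (πstar x))
        * h.rhat t x (πstar x) + bonus M Emax lam ell h t x (πstar x) := rfl
      have hrh := h.rhat_mem M.Rmax_pos.le hc.reward_mem t x (πstar x)
      by_cases hN : h.N t x (πstar x) = 0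
      · have h4 := Vmax_le_bonus (M := M) hE hlam hlam1 hell hN
        have h5 : ∀ s', h.Phat t x (πstar x) s' = 0 := fun s' => by simp [Trajectory.Phat, hN]
        have h6 := mul_nonneg (sub_nonneg.2 (PU_mem (h := h) (t := t) hE x (πstar x)).2) hrh.1
        simp only [h5, zero_mul, sum_const_zero, mul_zero, add_zero] at h3
        linarith
      · have hn : (0 : ℝ) < h.N t x (πstar x) := by exact_mod_cast Nat.pos_of_ne_zero hN
        have h4 := bonus_eq (M := M) (ell := ell) (by linarith : 0 < Emax) hlam hN
        have h5 := PU_mul_Rmax_le (M := M) hE hlam hN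
        have h6 := mul_le_mul_of_nonneg_left hrh.2 (PU_mem (h := h) (t := t) hE x (πstar x)).1
        have h7 := hc.lower x (πstar x)
        rw [hopt.lookahead_eq, neg_mul, ← mul_neg] at h7
        have h8 := le_of_mul_mul_le hn hc.tilt_pos hlam hc.level_le h7
        have h9 : 0 ≤ M.Vmax * ell t / (lam t * h.N t x (πstar x)) := by positivity
        change -(_ + M.γ * ∑ s', h.Phat t x (πstar x) s' * g s' - g x) ≤ _ at h8
        -- The constant shift Φ leaves (1-γ)Φ after discounting. Together with the two parts of the
        -- bonus it covers the deviation 5Gℓ/(λN) and the reward lost to the factor 1 - `h.PU`.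
        simp only [mul_sub, sum_sub_distrib, ← sum_mul, h.sum_Phat hN, one_mul]
        rw [hrew, h4] at h3
        nlinarith) s
  linarith

/-- Upper transform of the optimal value. -/
noncomputable def upperValue (M : DiscountedMDP S A) (θ : ℝ) (s : S) : ℝ :=
  expTransform θ (upperCoeff θ M.Vmax) (M.optValue s)

theorem IsConcentrated.upperValue_mem (hc : IsConcentrated M lam ell δ h t θ L) (s : S) :
    M.optValue s ≤ upperValue M θ s ∧ upperValue M θ s ≤ M.optValue s + θ * M.Vmax * M.Vmax :=
  ⟨le_expTransform_upper hc.tilt_pos (by linarith [hc.tilt_le]) (optValue_mem M s),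
    expTransform_upper_le hc.tilt_pos hc.tilt_le (optValue_mem M s)⟩

/-- The excess of the agent's value over the transformed optimal value satisfies an empirical
Bellman inequality along the greedy policy. -/
theorem IsConcentrated.excess_le (hc : IsConcentrated M lam ell δ h t θ L) (hE : 1 ≤ Emax)
    (hlam : 0 < lam t) {πstar : S → A} (hopt : M.IsOptimal πstar) {π : S → A}
    (hπ : IsGreedy M Emax lam ell h t π) {s : S} (hN : h.N t s (π s) ≠ 0) :
    agentValue M Emax lam ell h t s - upperValue M θ s
      ≤ bonus M Emax lam ell h t s (π s)
        + 5 * (M.Vmax * ell t / (lam t * h.N t s (π s)))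
        - (M.optValue s - M.lookahead M.optValue s (π s))
        + M.γ * ∑ s', h.Phat t s (π s) s'
          * (agentValue M Emax lam ell h t s' - upperValue M θ s') := by
  have hn : (0 : ℝ) < h.N t s (π s) := by exact_mod_cast Nat.pos_of_ne_zero hN
  have h1 : agentValue M Emax lam ell h t s ≤ (1 - h.PU Emax t s (π s)) * h.rhat t s (π s)
      + bonus M Emax lam ell h t s (π s)
      + M.γ * ∑ s', h.Phat t s (π s) s' * agentValue M Emax lam ell h t s' :=
    (hπ s).symm.le.trans (min_le_left _ _)
  have hrh := h.rhat_mem M.Rmax_pos.le hc.reward_mem t s (π s)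
  have h2 := mul_nonneg (PU_mem (h := h) (t := t) hE s (π s)).1 hrh.1
  have h3 := le_of_mul_mul_le hn hc.tilt_pos hlam hc.level_le (hc.upper s (π s))
  have hQ := M.lookahead_mem (optValue_mem M) s (π s)
  have h4 := sub_le_expTransform_upper_sub hc.tilt_pos (by linarith [hc.tilt_le] : θ * M.Vmax < 1)
    hQ.1 (hopt.lookahead_le s (π s)) (M.optValue_le_Vmax s)
  simp only [mul_sub, sum_sub_distrib, upperValue] at h3 h4 ⊢
  linarith

end

variable [MeasurableSingletonClass S] [Nonempty A] [Nonempty S]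

omit [Nonempty A] [Nonempty S] in
-- The function f may depend on the data, since the transition bounds hold for each entry and all
-- tilts simultaneously.
theorem IsConcentrated.sum_excess_le (hc : IsConcentrated M lam ell δ h t θ L) {s : S} {a : A}
    (hN : h.N t s a ≠ 0) {f : S → ℝ} (hf : ∀ s, |f s| ≤ 1 / 2) :
    ∑ s', h.Phat t s a s' * f s' ≤ Real.log (∑ s', M.P s a s' * Real.exp (f s'))
      + Fintype.card S * (3 * ell3 δ h t s a / h.N t s a) := by
  have hn : (0 : ℝ) < h.N t s a := by exact_mod_cast Nat.pos_of_ne_zero hN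
  refine sum_mul_le_log_sum_mul_exp (M.P_nonneg s a) (M.sum_P s a) (h.sum_Phat hN) hf
    fun i x hx => ?_
  have h1 := hc.transition s a i x hx
  rw [← sub_le_iff_le_add', le_div_iff₀ hn]
  linarith

theorem IsConcentrated.regret_le (hc : IsConcentrated M lam ell δ h t θ L) (hE : 1 ≤ Emax)
    (hδ : 0 < δ) (hδ1 : δ ≤ 1) (hlam : 0 < lam t) (hlam1 : lam t ≤ 1) (hell : 1 ≤ ell t)
    {πstar : S → A} (hopt : M.IsOptimal πstar) {π : S → A}
    (hπ : IsGreedy M Emax lam ell h t π) (s : S) :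
    M.optValue s - M.value π s
      ≤ 2 * J M Emax lam ell δ h t π s + 15 / 14 * (lam t * M.Vmax) + 2 * (M.Rmax * lam t) := by
  have hG := M.Vmax_pos
  set G := M.Vmax with hGdef
  set D : S → ℝ := fun s => M.optValue s - M.value π s with hD
  set d : S → ℝ := fun s => agentValue M Emax lam ell h t s - upperValue M θ s with hd
  -- The scale 12G puts d/(12G) in [-7/60, 1/12] and the error terms below 1/10. It turns the
  -- transition error 3Sℓ₃/N into 36GSℓ₃/N, and 36 is 6/5 of the 30 in `beta`.
  set z : S → ℝ := fun s => 12 * G * (Real.exp (d s / (12 * G)) - 1) with hz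
  have hdz : ∀ s, d s ≤ z s := fun s => by
    have := Real.add_one_le_exp (d s / (12 * G))
    calc d s = 12 * G * (d s / (12 * G)) := by field_simp
      _ ≤ _ := by simp only [hz]; gcongr; linarith
  have hD0 : ∀ s, 0 ≤ D s := fun s => sub_nonneg.2 (M.value_le_optValue π s)
  have hDG : ∀ s, D s ≤ G := fun s => by
    linarith [M.optValue_le_Vmax s, M.value_nonneg π s]
  have hdG : ∀ s, d s ≤ G := fun s => by
    linarith [agentValue_le_Vmax (M := M) (Emax := Emax) (lam := lam) (ell := ell) (h := h)
      (t := t) s, (hc.upperValue_mem s).1, M.optValue_nonneg s]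
  have hdlow : ∀ s, -(7 / 5 * G) ≤ d s := fun s => by
    have h1 := agentValue_nonneg (M := M) hE hlam hell hc.reward_mem s
    have h2 := (hc.upperValue_mem s).2
    have h3 := mul_le_mul_of_nonneg_right hc.tilt_le hG.le
    linarith [M.optValue_le_Vmax s]
  have hdD : ∀ s, d s + D s ≤ G := fun s => by
    linarith [agentValue_le_Vmax (M := M) (Emax := Emax) (lam := lam) (ell := ell) (h := h)
      (t := t) s, (hc.upperValue_mem s).1, M.value_nonneg π s]
  -- The comparison where J is truncated: there (42/25)J equals (42/25)G.
  have hcap : ∀ s, z s + 21 / 25 * D s ≤ 42 / 25 * G := fun s => by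
    have h1 := hdD s
    have h2 := hD0 s
    rcases le_total (d s) 0 with hneg | hpos
    · have : z s ≤ 0 := mul_nonpos_of_nonneg_of_nonpos (by positivity)
        (sub_nonpos.2 (Real.exp_le_one_iff.2 (div_nonpos_of_nonpos_of_nonneg hneg (by positivity))))
      linarith [hDG s]
    · have hx : d s / (12 * G) ≤ 1 / 12 := by
        rw [div_le_iff₀ (by positivity)]; linarith [hdG s]
      have hx0 : 0 ≤ d s / (12 * G) := by positivity
      have h3 := exp_le_one_add_add_sq hx0 (by linarith)
      have h4 : z s ≤ 12 * G * (13 / 12 * (d s / (12 * G))) := by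
        simp only [hz]
        gcongr
        nlinarith
      have h5 : 12 * G * (13 / 12 * (d s / (12 * G))) = 13 / 12 * d s := by field_simp
      linarith
  -- The factor 21/25 is what the gap retains in the recursion, and 42/25 = (7/5)(6/5) combines the
  -- recursion with the bound B ≤ (6/5)β.
  have hmain := nonpos_of_le_discounted_sum M.γ_nonneg M.γ_lt_one
    (K := fun s s' => M.P s (π s) s')
    (fun s s' => M.P_nonneg _ _ _) (fun s => (M.sum_P s (π s)).le)
    (f := fun s => z s + 21 / 25 * D s - 42 / 25 * J M Emax lam ell δ h t π s) (fun x hx => by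
      have hJ := J_eq (M := M) (Emax := Emax) (lam := lam) (ell := ell) (h := h) (t := t) δ π x
      have hJnn : 0 ≤ M.γ * ∑ s', M.P x (π x) s' * J M Emax lam ell δ h t π s' :=
        mul_nonneg M.γ_nonneg (sum_nonneg fun y _ =>
          mul_nonneg (M.P_nonneg _ _ _) (J_nonneg hE hδ hδ1 hlam hell π y))
      -- Positivity at x rules out J = G by `hcap`. Hence J is not truncated at x and the pair has
      -- been visited.
      have hJlt : J M Emax lam ell δ h t π x < G := by
        by_contra! hge
        linarith [hcap x]
      rw [hJ, min_lt_iff] at hJlt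
      replace hJlt := hJlt.resolve_right (lt_irrefl _)
      rw [min_eq_left hJlt.le] at hJ
      have hN : h.N t x (π x) ≠ 0 := fun h0 => by
        rw [beta, if_pos h0] at hJlt
        linarith
      have hn : (0 : ℝ) < h.N t x (π x) := by exact_mod_cast Nat.pos_of_ne_zero hN
      have hβ := le_beta (M := M) (ell := ell) (δ := δ) hE hlam hell hN
      have hbon := bonus_eq (M := M) (ell := ell) (by linarith : 0 < Emax) hlam hN
      have hbon' : 0 ≤ M.Vmax / (lam t * Emax * h.N t x (π x)) := by positivity
      have hex := hc.excess_le hE hlam hopt hπ hN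
      have hf : ∀ y, |d y / (12 * G)| ≤ 1 / 2 := fun y => by
        rw [abs_le, le_div_iff₀ (by positivity), div_le_iff₀ (by positivity)]
        constructor <;> linarith [hdG y, hdlow y]
      have htr := hc.sum_excess_le hN hf
      set X := M.Vmax * ell t / (lam t * h.N t x (π x)) with hX
      set Z := M.Vmax * Fintype.card S * ell3 δ h t x (π x) / h.N t x (π x) with hZ
      have hell3 := ell3_ge (h := h) (t := t) hδ hδ1 x (π x)
      have hX0 : 0 ≤ X := by positivity
      have hZ0 : 0 ≤ Z := by positivity
      set Y := ∑ s', M.P x (π x) s' * Real.exp (d s' / (12 * G)) with hY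
      set gap := M.optValue x - M.lookahead M.optValue x (π x) with hgap
      have hgap0 : 0 ≤ gap := sub_nonneg.2 (hopt.lookahead_le x (π x))
      have hgapG : gap ≤ G := by
        linarith [M.optValue_le_Vmax x, (M.lookahead_mem (optValue_mem M) x (π x)).1]
      have hYlo : Real.exp (-(7 / 60)) ≤ Y := by
        calc Real.exp (-(7 / 60)) = ∑ s', M.P x (π x) s' * Real.exp (-(7 / 60)) := by
              rw [← sum_mul, M.sum_P, one_mul]
          _ ≤ Y := sum_le_sum fun y _ => mul_le_mul_of_nonneg_left (Real.exp_le_exp.2 (by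
              rw [le_div_iff₀ (by positivity)]; linarith [hdlow y])) (M.P_nonneg _ _ _)
      have hYhi : Y ≤ Real.exp (1 / 12) := by
        calc Y ≤ ∑ s', M.P x (π x) s' * Real.exp (1 / 12) :=
              sum_le_sum fun y _ => mul_le_mul_of_nonneg_left (Real.exp_le_exp.2 (by
                rw [div_le_iff₀ (by positivity)]; linarith [hdG y])) (M.P_nonneg _ _ _)
          _ = _ := by rw [← sum_mul, M.sum_P, one_mul]
      have hYpos := (Real.exp_pos _).trans_le hYlo
      set B := bonus M Emax lam ell h t x (π x) + 5 * X + 36 * Z with hB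
      have hB0 : 0 ≤ B := by
        have := bonus_nonneg (M := M) (h := h) hE hlam hell x (π x)
        positivity
      -- A fifth of the bonus contributes at least (7/5)X and (6/5)·3X gives (18/5)X: together
      -- exactly 5X.
      have hBβ : B ≤ 6 / 5 * beta M Emax lam ell δ h t x (π x) := by linarith
      have hβG : beta M Emax lam ell δ h t x (π x) < G := by linarith
      have hstep : d x / (12 * G) ≤ B / (12 * G) - gap / (12 * G) + M.γ * Real.log Y := by
        have e1 : ∑ s', h.Phat t x (π x) s' * (d s' / (12 * G))
            = (∑ s', h.Phat t x (π x) s' * d s') / (12 * G) := by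
          rw [sum_div]; exact sum_congr rfl fun y _ => by ring
        have e2 : Fintype.card S * (3 * ell3 δ h t x (π x) / h.N t x (π x))
            = 36 * Z / (12 * G) := by
          rw [hZ, ← hGdef]; field_simp; norm_num
        rw [e1, e2] at htr
        have e3 : d x / (12 * G) ≤ (bonus M Emax lam ell h t x (π x) + 5 * X - gap
            + M.γ * ∑ s', h.Phat t x (π x) s' * d s') / (12 * G) := by gcongr
        have e4 := mul_le_mul_of_nonneg_left htr M.γ_nonneg
        have e5 : M.γ * (36 * Z / (12 * G)) ≤ 36 * Z / (12 * G) :=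
          mul_le_of_le_one_left (by positivity) M.γ_lt_one.le
        refine e3.trans ?_
        rw [add_div, sub_div, mul_div_assoc, hB, add_div _ (36 * Z)]
        linarith
      have hrec := exp_recursion_step M.γ_nonneg M.γ_lt_one.le (b := B / (12 * G))
        (u := gap / (12 * G)) (by positivity)
        (by rw [div_le_iff₀ (by positivity)]; linarith) (by positivity)
        (by rw [div_le_iff₀ (by positivity)]; linarith)
        ((Real.le_log_iff_exp_le hYpos).2 hYlo) ((Real.log_le_iff_le_exp hYpos).2 hYhi) hstep
      rw [Real.exp_log hYpos] at hrec
      have hrec' := mul_le_mul_of_nonneg_left hrec (by positivity : 0 ≤ 12 * G)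
      have e1 : 12 * G * (Real.exp (d x / (12 * G)) - 1 + 21 / 25 * (gap / (12 * G)))
          = z x + 21 / 25 * gap := by simp only [hz]; field_simp
      have e2 : ∑ s', M.P x (π x) s' * z s' = 12 * G * (Y - 1) := by
        have : ∀ y, M.P x (π x) y * z y = 12 * G * (M.P x (π x) y * Real.exp (d y / (12 * G)))
            - 12 * G * M.P x (π x) y := fun y => by simp only [hz]; ring
        simp only [this, sum_sub_distrib, ← mul_sum, M.sum_P]
        ring
      have e3 : 12 * G * (7 / 5 * (B / (12 * G)) + M.γ * (Y - 1))
          = 7 / 5 * B + M.γ * ∑ s', M.P x (π x) s' * z s' := by rw [e2]; field_simp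
      rw [e1, e3] at hrec'
      have e4 : D x = gap + M.γ * ∑ s', M.P x (π x) s' * D s' := by
        simp only [hD, hgap, mul_sub, sum_sub_distrib]
        rw [M.value_eq π x]
        unfold DiscountedMDP.lookahead
        ring
      have e5 : M.γ * ∑ s', M.P x (π x) s'
            * (z s' + 21 / 25 * D s' - 42 / 25 * J M Emax lam ell δ h t π s')
          = M.γ * ∑ s', M.P x (π x) s' * z s' + 21 / 25 * (M.γ * ∑ s', M.P x (π x) s' * D s')
            - 42 / 25 * (M.γ * ∑ s', M.P x (π x) s' * J M Emax lam ell δ h t π s') := by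
        simp only [mul_add, mul_sub, sum_add_distrib, sum_sub_distrib, mul_left_comm _ (_ / _ : ℝ),
          ← mul_sum]
      rw [e5]
      linarith) s
  have h1 := hc.optimism hE hlam hlam1 hell hopt s
  have h2 := sub_le_expTransform_lower hc.tilt_pos (optValue_mem M s)
  have h3 := (hc.upperValue_mem s).2
  have h4 := mul_le_mul_of_nonneg_right hc.tilt_le_lam hG.le
  have h5 := hdz s
  have h6 : 0 < M.Rmax * lam t := mul_pos M.Rmax_pos hlam
  have h7 : 0 < lam t * G := mul_pos hlam hG
  change M.optValue s - M.value π s ≤ _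
  have h8 : d s = agentValue M Emax lam ell h t s - upperValue M θ s := rfl
  have h9 : D s = M.optValue s - M.value π s := rfl
  rw [h9] at hmain
  -- Here -d ≤ (1/2 + 1)θG² + Φ ≤ (9/10)λG + Φ. Dividing by 21/25 gives the coefficient 15/14 and
  -- (25/21)Φ ≤ 2Φ.
  linarith

end EUBRL

/-! ### Geometric grids of tilts and their confidence levels. -/

theorem log_le_two_mul_log {x y : ℝ} (hx : 0 < x) (h : x ≤ y ^ 2) :
    Real.log x ≤ 2 * Real.log y := by
  have := Real.log_le_log hx h
  rwa [Real.log_pow] at this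

theorem two_fifths_le_log : (2 / 5 : ℝ) ≤ Real.log (3 / 2) := by
  rw [Real.le_log_iff_exp_le (by norm_num)]
  refine le_of_pow_le_pow_left₀ (n := 5) (by norm_num) (by norm_num) ?_
  rw [← Real.exp_nat_mul, show ((5 : ℕ) : ℝ) * (2 / 5) = 1 + 1 by norm_num, Real.exp_add]
  have h1 := Real.exp_one_lt_d9
  have h2 := Real.exp_pos 1
  nlinarith

/-- A grid index n with x ≤ (2/3)^n and x ≥ 1/y is at most logarithmic in y, as log(3/2) ≥ 2/5. -/
theorem natCast_le_mul_log {n : ℕ} {x y : ℝ} (hx : 0 < x) (hn : x ≤ (2 / 3) ^ n)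
    (hxy : 1 ≤ x * y) : (n : ℝ) ≤ 5 / 2 * Real.log y := by
  have hpow : (3 / 2 : ℝ) ^ n * (2 / 3) ^ n = 1 := by rw [← mul_pow]; norm_num
  have h1 : (3 / 2 : ℝ) ^ n ≤ y := by
    refine le_of_mul_le_mul_left ?_ hx
    refine le_trans ?_ hxy
    rw [← hpow, mul_comm]
    gcongr
  have h2 := Real.log_le_log (by positivity) h1
  rw [Real.log_pow] at h2
  have h3 := mul_le_mul_of_nonneg_left two_fifths_le_log (Nat.cast_nonneg (α := ℝ) n)
  linarith

/-- The deviation bound on a geometric grid of tilts extends to all tilts. -/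
theorem tilt_bound_of_le {n p q ℓ x c : ℝ} (hn : 0 ≤ n) (hq : 0 ≤ q) (hc : 2 / 3 ≤ c)
    (hc1 : c ≤ 1) (hℓ : 0 ≤ ℓ) (h : n * (c * x * p - q * (Real.exp (c * x) - 1)) ≤ 2 * ℓ) :
    n * (x * p - q * (Real.exp x - 1)) ≤ 3 * ℓ := by
  have h1 := exp_convex_comb_le (a := 0) (b := x) (p := c) (by linarith) hc1
  rw [mul_zero, zero_add, Real.exp_zero, mul_one] at h1
  have h2 := mul_le_mul_of_nonneg_left (mul_le_mul_of_nonneg_left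
    (show Real.exp (c * x) - 1 ≤ c * (Real.exp x - 1) by linarith) hq) hn
  have h3 : c * (n * (x * p - q * (Real.exp x - 1))) ≤ 2 * ℓ := by linarith
  refine le_of_mul_le_mul_left (h3.trans ?_) (by linarith : 0 < c)
  nlinarith

theorem transition_bound_of_grid {n : ℕ} {p q ℓ : ℝ} (hp : p ∈ Set.Icc 0 1) (hq : q ∈ Set.Icc 0 1)
    (hℓ : 1 ≤ ℓ) {level : ℕ → ℝ}
    (hlevel : ∀ j : ℕ, (j : ℝ) ≤ 5 / 2 * Real.log n → level (j + 1) ≤ 2 * ℓ)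
    (hpos : ∀ j, n * ((2 / 3) ^ j * p - q * (Real.exp ((2 / 3) ^ j) - 1)) ≤ level j)
    (hneg : ∀ j, n * (-(2 / 3) ^ j * p - q * (Real.exp (-(2 / 3) ^ j) - 1)) ≤ level j)
    {x : ℝ} (hx : |x| ≤ 1) : n * (x * p - q * (Real.exp x - 1)) ≤ 3 * ℓ := by
  have hn : (0 : ℝ) ≤ n := Nat.cast_nonneg n
  -- Tilts below 1/n are trivial because exp x - 1 ≥ x bounds the deviation by |x|n ≤ 1. Larger ones
  -- are compared with the grid point just below |x|, of index j + 1.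
  rcases le_or_gt (|x| * n) 1 with hsmall | hbig
  · have h1 : x * p - q * (Real.exp x - 1) ≤ |x| := by
      have h2 := mul_le_mul_of_nonneg_left (Real.add_one_le_exp x) hq.1
      have h3 : x * (p - q) ≤ |x| * 1 := by
        refine (le_abs_self _).trans ?_
        rw [abs_mul]
        gcongr
        rw [abs_le]
        exact ⟨by linarith [hp.1, hq.2], by linarith [hp.2, hq.1]⟩
      linarith
    have := mul_le_mul_of_nonneg_left h1 hn
    linarith
  · have hx0 : 0 < |x| := by
      by_contra! h0
      nlinarith
    obtain ⟨j, hj1, hj2⟩ := exists_nat_pow_near_of_lt_one hx0 hx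
      (by norm_num : (0 : ℝ) < 2 / 3) (by norm_num)
    have hlev := hlevel j (natCast_le_mul_log hx0 hj2 hbig.le)
    have hc1 : (2 / 3 : ℝ) ^ (j + 1) / |x| ≤ 1 := (div_le_one hx0).2 hj1.le
    have hc : 2 / 3 ≤ (2 / 3 : ℝ) ^ (j + 1) / |x| := by
      rw [le_div_iff₀ hx0, pow_succ]
      linarith
    refine tilt_bound_of_le hn hq.1 hc hc1 (by linarith) ?_
    rcases abs_cases x with ⟨habs, _⟩ | ⟨habs, _⟩
    · rw [show (2 / 3 : ℝ) ^ (j + 1) / |x| * x = (2 / 3) ^ (j + 1) by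
        rw [habs] at hx0 ⊢; field_simp]
      exact (hpos (j + 1)).trans hlev
    · rw [show (2 / 3 : ℝ) ^ (j + 1) / |x| * x = -(2 / 3) ^ (j + 1) by
        rw [habs] at hx0 ⊢
        have : x ≠ 0 := by rintro rfl; simp at hx0
        field_simp]
      exact (hneg (j + 1)).trans hlev

namespace EUBRL

/-- The union over tilts costs only a polynomial in j, of order w. Doubling the logarithm squares
its argument and absorbs this. -/
theorem log_level_le {S A δ w : ℝ} {j : ℕ} (hS : 1 ≤ S) (hA : 1 ≤ A) (hδ : 0 < δ) (hδ1 : δ ≤ 1)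
    (hw : 0 ≤ w) (hj : (j : ℝ) ≤ 5 / 2 * w) :
    Real.log ((j + 1) * (j + 2) / (δ / (4 * S * A)))
      ≤ 2 * Real.log (24 * S * A * (1 + w) / δ) := by
  have hj0 : (0 : ℝ) ≤ j := Nat.cast_nonneg j
  refine log_le_two_mul_log (by positivity) ?_
  rw [div_div_eq_mul_div, div_pow, div_le_div_iff₀ hδ (by positivity)]
  have h1 : ((j : ℝ) + 1) * (j + 2) ≤ 25 / 4 * (1 + w) ^ 2 := by nlinarith
  have h2 : (1 : ℝ) ≤ S * A := one_le_mul_of_one_le_of_one_le hS hA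
  calc ((j : ℝ) + 1) * (j + 2) * (4 * S * A) * δ ^ 2
      = (((j : ℝ) + 1) * (j + 2)) * (4 * (S * A)) * δ * δ := by ring
    _ ≤ (25 / 4 * (1 + w) ^ 2) * (4 * (S * A) * (S * A)) * 1 * δ := by
        gcongr
        exact le_mul_of_one_le_right (by positivity) h2
    _ ≤ (24 * S * A * (1 + w)) ^ 2 * δ := by
        gcongr
        nlinarith [mul_nonneg (sq_nonneg (1 + w)) (sq_nonneg (S * A))]

/-- The index is shifted by one because the grid point lies below the tilt: (2 + 5w/2)(3 + 5w/2) ≤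
(25/4)(1 + w)². The extra factor S from the union over next states is absorbed by the square. -/
theorem log_transition_level_le {S A δ w : ℝ} {j : ℕ} (hS : 1 ≤ S) (hA : 1 ≤ A) (hδ : 0 < δ)
    (hδ1 : δ ≤ 1) (hw : 0 ≤ w) (hj : (j : ℝ) ≤ 5 / 2 * w) :
    Real.log (((j + 1 : ℕ) + 1) * ((j + 1 : ℕ) + 2) / (δ / (4 * S * A * S)))
      ≤ 2 * Real.log (12 * S * A * (1 + w) / δ) := by
  have hj0 : (0 : ℝ) ≤ j := Nat.cast_nonneg j
  refine log_le_two_mul_log (by positivity) ?_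
  rw [div_div_eq_mul_div, div_pow, div_le_div_iff₀ hδ (by positivity)]
  have h1 : (((j + 1 : ℕ) : ℝ) + 1) * ((j + 1 : ℕ) + 2) ≤ 25 / 4 * (1 + w) ^ 2 := by
    push_cast; nlinarith
  calc (((j + 1 : ℕ) : ℝ) + 1) * ((j + 1 : ℕ) + 2) * (4 * S * A * S) * δ ^ 2
      = ((((j + 1 : ℕ) : ℝ) + 1) * ((j + 1 : ℕ) + 2)) * (4 * S ^ 2 * A) * δ * δ := by ring
    _ ≤ (25 / 4 * (1 + w) ^ 2) * (4 * S ^ 2 * (A * A)) * 1 * δ := by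
        gcongr
        exact le_mul_of_one_le_right (by positivity) hA
    _ ≤ (12 * S * A * (1 + w)) ^ 2 * δ := by
        gcongr
        nlinarith [mul_nonneg (sq_nonneg (1 + w)) (sq_nonneg (S * A))]

theorem one_le_log_of_le {S A : Type*} [Fintype S] [Fintype A] [Nonempty S]
    [Nonempty A] {δ w x : ℝ} (hδ : 0 < δ) (hδ1 : δ ≤ 1) (hw : 0 ≤ w)
    (hx : x = Real.log (24 * Fintype.card S * Fintype.card A * (1 + w) / δ)) : 1 ≤ x := by
  have hS : (1 : ℝ) ≤ Fintype.card S := by exact_mod_cast Fintype.card_pos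
  have hA : (1 : ℝ) ≤ Fintype.card A := by exact_mod_cast Fintype.card_pos
  rw [hx, Real.le_log_iff_exp_le (by positivity), le_div_iff₀ hδ]
  have h2 : (1 : ℝ) ≤ Fintype.card S * Fintype.card A := one_le_mul_of_one_le_of_one_le hS hA
  have h3 : (1 : ℝ) ≤ Fintype.card S * Fintype.card A * (1 + w) :=
    one_le_mul_of_one_le_of_one_le h2 (by linarith)
  nlinarith [Real.exp_one_lt_d9, Real.exp_pos 1]

theorem resistance_le {S A : Type*} [DecidableEq S] [DecidableEq A] {Emax : ℝ}
    {h : Trajectory S A} {t : ℕ} (hE : 1 ≤ Emax) (π πstar : S → A) (s : S) :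
    resistance Emax h t π πstar s ≤ 23 / 7 := by
  have h1 := (PU_mem (h := h) (t := t) hE s (π s)).2
  have h2 := (PU_mem (h := h) (t := t) hE s (πstar s)).2
  unfold resistance
  linarith

/-- Deviation bounds for all steps, pairs and tilts of a trajectory. -/
structure IsTypical {S A : Type*} [MeasurableSpace S] [Fintype S] [Fintype A] [DecidableEq S]
    [DecidableEq A] (M : DiscountedMDP S A) (δ : ℝ) (θ : ℕ → ℝ) (h : Trajectory S A) : Prop where
  reward_mem : ∀ t, h.reward t ∈ Set.Icc 0 M.Rmax
  lower : ∀ s a (j t : ℕ), h.N t s a * (-θ j * (h.rhat t s a + M.γ * ∑ s', h.Phat t s a s' *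
      expTransform (-θ j) (lowerCoeff (θ j) M.Vmax) (M.optValue s')
    - expTransform (-θ j) (lowerCoeff (θ j) M.Vmax) (M.lookahead M.optValue s a)))
    ≤ Real.log ((j + 1) * (j + 2) / (δ / (4 * Fintype.card S * Fintype.card A)))
  upper : ∀ s a (j t : ℕ), h.N t s a * (θ j * (h.rhat t s a + M.γ * ∑ s', h.Phat t s a s' *
      expTransform (θ j) (upperCoeff (θ j) M.Vmax) (M.optValue s')
    - expTransform (θ j) (upperCoeff (θ j) M.Vmax) (M.lookahead M.optValue s a)))
    ≤ Real.log ((j + 1) * (j + 2) / (δ / (4 * Fintype.card S * Fintype.card A)))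
  transition_pos : ∀ s a s' (j t : ℕ), h.N t s a * ((2 / 3) ^ j * h.Phat t s a s'
      - M.P s a s' * (Real.exp ((2 / 3) ^ j) - 1))
    ≤ Real.log ((j + 1) * (j + 2) / (δ / (4 * Fintype.card S * Fintype.card A * Fintype.card S)))
  transition_neg : ∀ s a s' (j t : ℕ), h.N t s a * (-(2 / 3) ^ j * h.Phat t s a s'
      - M.P s a s' * (Real.exp (-(2 / 3) ^ j) - 1))
    ≤ Real.log ((j + 1) * (j + 2) / (δ / (4 * Fintype.card S * Fintype.card A * Fintype.card S)))

section Typical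

variable {S A Ω : Type*} [MeasurableSpace S] [Fintype S] [Fintype A] [DecidableEq S]
  [DecidableEq A] [Nonempty S] [Nonempty A] [MeasurableSpace A] [MeasurableSingletonClass S]
  [MeasurableSingletonClass A] {mΩ : MeasurableSpace Ω}
  {M : DiscountedMDP S A} {Emax : ℝ} {lam ell : ℕ → ℝ}
  {μ : Measure Ω} [IsProbabilityMeasure μ] {ℱ : Filtration ℕ mΩ} {state : ℕ → Ω → S}
  {reward : ℕ → Ω → ℝ} {policy : ℕ → Ω → S → A}

theorem IsRun.measure_not_isTypical_le
    (hrun : IsRun M Emax lam ell μ ℱ state reward policy) {δ : ℝ} (hδ : 0 < δ) {θ : ℕ → ℝ}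
    (hθ : ∀ j, 0 < θ j) (hθ1 : ∀ j, θ j * M.Vmax < 1) :
    μ {ω | ¬ IsTypical M δ θ (traj state reward policy ω)} ≤ ENNReal.ofReal δ := by
  have hS : (0 : ℝ) < Fintype.card S := by exact_mod_cast Fintype.card_pos
  have hA : (0 : ℝ) < Fintype.card A := by exact_mod_cast Fintype.card_pos
  -- Half of δ goes to the 2SA return bounds and half to the 2S²A transition bounds.
  set ε₁ : ℝ := δ / (4 * Fintype.card S * Fintype.card A) with hε₁
  set ε₂ : ℝ := δ / (4 * Fintype.card S * Fintype.card A * Fintype.card S) with hε₂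
  have hε₁0 : 0 < ε₁ := by positivity
  have hε₂0 : 0 < ε₂ := by positivity
  set T : Ω → Trajectory S A := traj state reward policy with hT
  set dev : (S × A) → (ℕ → ℝ) → (ℕ → ℝ) → Set Ω := fun p θ κ =>
    {ω | (∀ t, reward t ω ∈ Set.Icc 0 M.Rmax) ∧ ∃ (j : ℕ) (t : ℕ),
      Real.log ((j + 1) * (j + 2) / ε₁) ≤ (T ω).N t p.1 p.2 *
        (θ j * ((T ω).rhat t p.1 p.2 + M.γ * ∑ s', (T ω).Phat t p.1 p.2 s' *
              expTransform (θ j) (κ j) (M.optValue s')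
          - expTransform (θ j) (κ j) (M.lookahead M.optValue p.1 p.2)))} with hdev
  set tdev : ((S × A) × S) → (ℕ → ℝ) → Set Ω := fun p x =>
    {ω | ∃ (j : ℕ) (t : ℕ), Real.log ((j + 1) * (j + 2) / ε₂) ≤
      (T ω).N t p.1.1 p.1.2 * (x j * (T ω).Phat t p.1.1 p.1.2 p.2
        - M.P p.1.1 p.1.2 p.2 * (Real.exp (x j) - 1))} with htdev
  set lo : ℕ → ℝ := fun j => -θ j with hlo
  set lc : ℕ → ℝ := fun j => lowerCoeff (θ j) M.Vmax with hlc
  set uc : ℕ → ℝ := fun j => upperCoeff (θ j) M.Vmax with huc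
  set xp : ℕ → ℝ := fun j => (2 / 3) ^ j with hxp
  set xn : ℕ → ℝ := fun j => -(2 / 3) ^ j with hxn
  have hsub : {ω | ¬ IsTypical M δ θ (T ω)} ⊆ {ω | ¬ ∀ t, reward t ω ∈ Set.Icc 0 M.Rmax} ∪
      ((⋃ p, (dev p lo lc ∪ dev p θ uc)) ∪ ⋃ p, (tdev p xp ∪ tdev p xn)) := by
    intro ω hω
    by_contra hgood
    simp only [Set.mem_union, Set.mem_iUnion, not_or, not_exists] at hgood
    obtain ⟨h1, h2, h3⟩ := hgood
    have h1' : ∀ t, reward t ω ∈ Set.Icc 0 M.Rmax := not_not.1 h1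
    refine hω ⟨h1', ?_, ?_, ?_, ?_⟩
    · intro s a j t
      by_contra! hlt
      exact (h2 (s, a)).1 ⟨h1', j, t, hlt.le⟩
    · intro s a j t
      by_contra! hlt
      exact (h2 (s, a)).2 ⟨h1', j, t, hlt.le⟩
    · intro s a s' j t
      by_contra! hlt
      exact (h3 ((s, a), s')).1 ⟨j, t, hlt.le⟩
    · intro s a s' j t
      by_contra! hlt
      exact (h3 ((s, a), s')).2 ⟨j, t, hlt.le⟩
  have m0 : μ {ω | ¬ ∀ t, reward t ω ∈ Set.Icc 0 M.Rmax} = 0 := ae_iff.1 hrun.ae_reward_mem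
  have hV := optValue_mem M
  have m1 : ∀ p, μ (dev p lo lc ∪ dev p θ uc) ≤ ENNReal.ofReal (2 * ε₁) := fun p => by
    rw [two_mul, ENNReal.ofReal_add hε₁0.le hε₁0.le]
    exact (measure_union_le _ _).trans (add_le_add
      (hrun.measure_return_deviation_le p.1 p.2 hV (fun j => (neg_neg_of_pos (hθ j)).ne)
        (fun j => exp_le_lowerCoeff (hθ j).le M.Vmax_pos.le) hε₁0)
      (hrun.measure_return_deviation_le p.1 p.2 hV (fun j => (hθ j).ne')
        (fun j => exp_le_upperCoeff (hθ1 j)) hε₁0))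
  have m2 : ∀ p, μ (tdev p xp ∪ tdev p xn) ≤ ENNReal.ofReal (2 * ε₂) := fun p => by
    rw [two_mul, ENNReal.ofReal_add hε₂0.le hε₂0.le]
    exact (measure_union_le _ _).trans (add_le_add
      (hrun.measure_transition_deviation_le p.1.1 p.1.2 p.2 xp hε₂0)
      (hrun.measure_transition_deviation_le p.1.1 p.1.2 p.2 xn hε₂0))
  have s1 : μ (⋃ p, (dev p lo lc ∪ dev p θ uc)) ≤ ENNReal.ofReal (δ / 2) := by
    refine (measure_iUnion_fintype_le _ _).trans ((sum_le_sum fun p _ => m1 p).trans_eq ?_)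
    rw [sum_const, card_univ, nsmul_eq_mul, ← ENNReal.ofReal_natCast,
      ← ENNReal.ofReal_mul (Nat.cast_nonneg _), Fintype.card_prod, Nat.cast_mul, hε₁]
    congr 1
    field_simp
    norm_num
  have s2 : μ (⋃ p, (tdev p xp ∪ tdev p xn)) ≤ ENNReal.ofReal (δ / 2) := by
    refine (measure_iUnion_fintype_le _ _).trans ((sum_le_sum fun p _ => m2 p).trans_eq ?_)
    rw [sum_const, card_univ, nsmul_eq_mul, ← ENNReal.ofReal_natCast,
      ← ENNReal.ofReal_mul (Nat.cast_nonneg _), Fintype.card_prod, Fintype.card_prod,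
      Nat.cast_mul, Nat.cast_mul, hε₂]
    congr 1
    field_simp
    norm_num
  refine (measure_mono hsub).trans ((measure_union_le _ _).trans ?_)
  rw [m0, zero_add]
  refine (measure_union_le _ _).trans ((add_le_add s1 s2).trans_eq ?_)
  rw [← ENNReal.ofReal_add (by positivity) (by positivity), add_halves]

end Typical

variable {S A : Type*} [MeasurableSpace S] [Fintype S] [Fintype A] [DecidableEq S]
  [DecidableEq A] [Nonempty S] [Nonempty A] [MeasurableSingletonClass S]
  {M : DiscountedMDP S A} {Emax δ : ℝ} {lam ell θ : ℕ → ℝ} {h : Trajectory S A} {t : ℕ}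

theorem IsTypical.isConcentrated (hh : IsTypical M δ θ h) (hδ : 0 < δ) (hδ1 : δ ≤ 1) {j : ℕ}
    (hθ : 0 < θ j) (h1 : θ j * M.Vmax ≤ 2 / 5) (h2 : θ j * M.Vmax ≤ 3 / 5 * lam t)
    (h3 : Real.log ((j + 1) * (j + 2) / (δ / (4 * Fintype.card S * Fintype.card A))) * lam t
      ≤ 5 * ell t * (θ j * M.Vmax)) :
    IsConcentrated M lam ell δ h t (θ j)
      (Real.log ((j + 1) * (j + 2) / (δ / (4 * Fintype.card S * Fintype.card A)))) := by
  have hS : (1 : ℝ) ≤ Fintype.card S := by exact_mod_cast Fintype.card_pos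
  have hA : (1 : ℝ) ≤ Fintype.card A := by exact_mod_cast Fintype.card_pos
  refine ⟨hθ, h1, h2, h3, hh.reward_mem, fun s a => hh.lower s a j t,
    fun s a => hh.upper s a j t, fun s a s' x hx => ?_⟩
  have mem_of {f : S → ℝ} (h0 : ∀ s, 0 ≤ f s) (h1 : ∑ s, f s ≤ 1) : f s' ∈ Set.Icc 0 1 :=
    ⟨h0 s', (single_le_sum (fun s _ => h0 s) (mem_univ s')).trans h1⟩
  exact transition_bound_of_grid (mem_of (h.Phat_nonneg t s a) (h.sum_Phat_le t s a))
    (mem_of (M.P_nonneg s a) (M.sum_P s a).le) (ell3_ge hδ hδ1 s a)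
    (level := fun j => Real.log ((j + 1) * (j + 2) /
      (δ / (4 * Fintype.card S * Fintype.card A * Fintype.card S))))
    (fun j hj => log_transition_level_le hS hA hδ hδ1 (Real.log_natCast_nonneg _) hj)
    (fun j => hh.transition_pos s a s' j t) (fun j => hh.transition_neg s a s' j t) hx

/-- While `λ t < 1`, the bonus of every pair reaches the truncation level. -/
theorem J_eq_Vmax_of_lam_mul_lt (hE : 1 ≤ Emax) (hδ : 0 < δ) (hδ1 : δ ≤ 1) (hlam : 0 < lam t)
    (hell : 1 ≤ ell t) (hlt : lam t * t < 1) (π : S → A) (s : S) :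
    J M Emax lam ell δ h t π s = M.Vmax := by
  have hG := M.Vmax_pos
  refine J_eq_Vmax_of_le_beta hE hδ hδ1 hlam hell ?_
  by_cases hN : h.N t s (π s) = 0
  · rw [beta, if_pos hN]
  · have hn : (0 : ℝ) < h.N t s (π s) := by exact_mod_cast Nat.pos_of_ne_zero hN
    have hnt : (h.N t s (π s) : ℝ) ≤ t := by exact_mod_cast h.N_le t s (π s)
    have h3 := ell3_ge (h := h) (t := t) hδ hδ1 s (π s)
    refine le_trans ?_ (le_beta hE hlam hell hN)
    rw [bonus_eq (by linarith) hlam hN]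
    have h4 : M.Vmax ≤ M.Vmax * ell t / (lam t * h.N t s (π s)) := by
      rw [le_div_iff₀ (by positivity)]
      have := mul_le_mul_of_nonneg_left hnt hlam.le
      gcongr
      linarith
    have h5 : 0 ≤ M.Vmax / (lam t * Emax * h.N t s (π s)) := by positivity
    have h6 : 0 ≤ M.Vmax * Fintype.card S * ell3 δ h t s (π s) / h.N t s (π s) := by positivity
    linarith

omit [DecidableEq S] [DecidableEq A] [MeasurableSingletonClass S] in
/-- The tilts used for the return deviations: proportional to the constant value of `lam`, or a
geometric grid. -/
theorem exists_tilts (M : DiscountedMDP S A) (hδ : 0 < δ) (hδ1 : δ ≤ 1)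
    (hlam : ∀ t, 0 < lam t ∧ lam t ≤ 1)
    (hell : ((∀ t, lam t = lam 0) ∧
        ∀ t, ell t = Real.log (24 * Fintype.card S * Fintype.card A / δ)) ∨
      ∀ t, ell t = Real.log
        (24 * Fintype.card S * Fintype.card A * (1 + Real.log ((t : ℝ) + 1)) / δ)) :
    ∃ θ : ℕ → ℝ, (∀ j, 0 < θ j ∧ θ j * M.Vmax ≤ 2 / 5) ∧ ∀ t, 1 ≤ ell t ∧
      (1 ≤ lam t * t → ∃ j : ℕ, θ j * M.Vmax ≤ 3 / 5 * lam t ∧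
        Real.log ((j + 1) * (j + 2) / (δ / (4 * Fintype.card S * Fintype.card A))) * lam t
          ≤ 5 * ell t * (θ j * M.Vmax)) := by
  have hS : (1 : ℝ) ≤ Fintype.card S := by exact_mod_cast Fintype.card_pos
  have hA : (1 : ℝ) ≤ Fintype.card A := by exact_mod_cast Fintype.card_pos
  have hG := M.Vmax_pos
  rcases hell with ⟨hconst, hell⟩ | hell
  · have e0 : ∀ t, 2 / 5 * lam 0 / M.Vmax * M.Vmax = 2 / 5 * lam t := fun t => by
      rw [div_mul_cancel₀ _ hG.ne', hconst t]
    refine ⟨fun _ => 2 / 5 * lam 0 / M.Vmax,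
      fun _ => ⟨by have := (hlam 0).1; positivity, by rw [e0 0]; linarith [(hlam 0).2]⟩,
      fun t => ⟨one_le_log_of_le (S := S) (A := A) hδ hδ1 le_rfl (by rw [hell t]; simp),
        fun _ => ⟨0, ?_, ?_⟩⟩⟩
    · rw [e0 t]; linarith [(hlam t).1]
    · rw [e0 t]
      have := log_level_le (j := 0) hS hA hδ hδ1 le_rfl (by simp)
      rw [add_zero, mul_one, ← hell t] at this
      nlinarith [(hlam t).1]
  · have e0 : ∀ j : ℕ, 2 / 5 * (2 / 3) ^ j / M.Vmax * M.Vmax = 2 / 5 * (2 / 3) ^ j := fun j =>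
      div_mul_cancel₀ _ hG.ne'
    have hlog : ∀ t : ℕ, 0 ≤ Real.log ((t : ℝ) + 1) := fun t =>
      Real.log_nonneg (le_add_of_nonneg_left (Nat.cast_nonneg t))
    refine ⟨fun j => 2 / 5 * (2 / 3) ^ j / M.Vmax, fun j => ⟨by positivity, ?_⟩,
      fun t => ⟨one_le_log_of_le (S := S) (A := A) hδ hδ1 (hlog t) (hell t), fun ht => ?_⟩⟩
    · rw [e0]
      linarith [pow_le_one₀ (n := j) (by norm_num : (0 : ℝ) ≤ 2 / 3) (by norm_num)]
    · obtain ⟨hl0, hl1⟩ := hlam t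
      obtain ⟨j, hj1, hj2⟩ := exists_nat_pow_near_of_lt_one hl0 hl1
        (by norm_num : (0 : ℝ) < 2 / 3) (by norm_num)
      -- With (2/3)^(j+1) < λ ≤ (2/3)^j, the tilt θG = (2/5)(2/3)^j lies between (2/5)λ and (3/5)λ.
      -- The assumption λt ≥ 1 bounds j by (5/2)log(t+1).
      refine ⟨j, ?_, ?_⟩
      · rw [e0]
        rw [pow_succ] at hj1
        linarith
      · rw [e0]
        have hell1 := one_le_log_of_le (S := S) (A := A) hδ hδ1 (hlog t) (hell t)
        have hj := natCast_le_mul_log (y := (t : ℝ) + 1) hl0 hj2 (by linarith)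
        have := log_level_le (j := j) hS hA hδ hδ1 (hlog t) hj
        rw [← hell t] at this
        calc _ ≤ 2 * ell t * lam t := mul_le_mul_of_nonneg_right this hl0.le
          _ ≤ 2 * ell t * (2 / 3) ^ j := by gcongr
          _ = _ := by ring

end EUBRL

/-! ### The main theorem. -/

theorem mainTheorem3 :
    ∃ C : ℝ, 0 < C ∧
      ∀ (S : Type u) (A : Type v) (Ω : Type w)
        [Fintype S] [Nonempty S] [DecidableEq S] [MeasurableSpace S] [MeasurableSingletonClass S]
        [Fintype A] [Nonempty A] [DecidableEq A] [MeasurableSpace A] [MeasurableSingletonClass A]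
        [mΩ : MeasurableSpace Ω]
        (M : DiscountedMDP S A) (δ Emax : ℝ) (lam ell : ℕ → ℝ)
        (μ : Measure Ω) [IsProbabilityMeasure μ] (ℱ : Filtration ℕ mΩ)
        (state : ℕ → Ω → S) (reward : ℕ → Ω → ℝ) (policy : ℕ → Ω → S → A),
        0 < δ → δ ≤ 1 → 1 ≤ Emax → (∀ t, 0 < lam t ∧ lam t ≤ 1) →
        (((∀ t, lam t = lam 0) ∧
            ∀ t, ell t = Real.log (24 * Fintype.card S * Fintype.card A / δ)) ∨
          ∀ t, ell t = Real.log
            (24 * Fintype.card S * Fintype.card A * (1 + Real.log ((t : ℝ) + 1)) / δ)) →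
        EUBRL.IsRun M Emax lam ell μ ℱ state reward policy →
        ENNReal.ofReal (1 - δ) ≤
          μ {ω | ∀ (πstar : S → A), M.IsOptimal πstar → ∀ (s : S) (t : ℕ),
            M.optValue s - M.value (policy t ω) s ≤
              (9 / 2 - EUBRL.resistance Emax (EUBRL.traj state reward policy ω) t
                  (policy t ω) πstar s) * lam t * M.Vmax
                + 2 * EUBRL.J M Emax lam ell δ (EUBRL.traj state reward policy ω) t
                    (policy t ω) s
                + C * (M.Rmax * lam t * (1 + M.Rmax * lam t / M.Vmax))} := by
  refine ⟨2, two_pos, ?_⟩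
  intro S A Ω _ _ _ _ _ _ _ _ _ _ mΩ M δ Emax lam ell μ _ ℱ state reward policy hδ hδ1 hE hlam
    hell hrun
  obtain ⟨θ, hθ, htilt⟩ := EUBRL.exists_tilts M hδ hδ1 hlam hell
  set good : Set Ω := {ω | EUBRL.IsTypical M δ θ (EUBRL.traj state reward policy ω)} with hgood
  have hbad : μ goodᶜ ≤ ENNReal.ofReal δ :=
    hrun.measure_not_isTypical_le hδ (fun j => (hθ j).1) (fun j => by linarith [(hθ j).2])
  have hgood_le : ENNReal.ofReal (1 - δ) ≤ μ good := by
    have h1 : 1 ≤ μ good + μ goodᶜ := by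
      rw [← measure_univ (μ := μ), ← Set.union_compl_self good]
      exact measure_union_le _ _
    rw [ENNReal.ofReal_sub _ hδ.le, ENNReal.ofReal_one]
    exact tsub_le_iff_right.2 (h1.trans (by gcongr))
  refine hgood_le.trans (measure_mono fun ω hω πstar hopt s t => ?_)
  obtain ⟨hl0, hl1⟩ := hlam t
  obtain ⟨hell1, hj⟩ := htilt t
  have hG := M.Vmax_pos
  have hres := EUBRL.resistance_le (h := EUBRL.traj state reward policy ω) (t := t) hE
    (policy t ω) πstar s
  have hΦ : 0 ≤ M.Rmax * lam t := mul_nonneg M.Rmax_pos.le hl0.le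
  have hΦ' : 0 ≤ M.Rmax * lam t * (M.Rmax * lam t / M.Vmax) := by positivity
  -- The resistance is at most 23/7 and 9/2 - 23/7 = 17/14, which exceeds the 15/14 of the
  -- deterministic bound.
  have hmain : 17 / 14 * (lam t * M.Vmax) ≤ (9 / 2 - EUBRL.resistance Emax
      (EUBRL.traj state reward policy ω) t (policy t ω) πstar s) * (lam t * M.Vmax) := by
    gcongr
    linarith
  have hlG : 0 ≤ lam t * M.Vmax := by positivity
  rw [mul_assoc _ (lam t) M.Vmax, mul_add (M.Rmax * lam t), mul_one]
  -- For λt < 1 no suitable tilt is needed: J equals `M.Vmax`, which already bounds the regret.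
  rcases le_or_gt 1 (lam t * t) with hlt | hlt
  · obtain ⟨j, h2, h3⟩ := hj hlt
    have := (hω.isConcentrated hδ hδ1 (hθ j).1 (hθ j).2 h2 h3).regret_le hE hδ hδ1 hl0 hl1 hell1
      hopt (hrun.greedy t ω) s
    linarith
  · rw [EUBRL.J_eq_Vmax_of_lam_mul_lt hE hδ hδ1 hl0 hell1 hlt]
    linarith [M.optValue_le_Vmax s, M.value_nonneg (policy t ω) s]
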